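/- Let $G$ be a compact Lie group with Lie algebra $\mathfrak g$, let $\langle\,,\rangle$ be a left-invariant Riemannian metric on $G$ and let $Q$ be a fixed bi-invariant Riemannian metric on $G$. The metric tensor $P\colon\mathfrak g\to\mathfrak g$ is the linear map with $\langle X,Y\rangle=Q(X,PY)$ for all $X,Y\in\mathfrak g$. Let $K$ be the invariance group of the metric, i.e. the largest subgroup of $G$ such that $\langle\,,\rangle$ is right $K$-invariant, and let $\mathfrak k$ be its Lie algebra. Let $U\subset G\times G$ be a closed subgroup with Lie algebra $\mathfrak u\subset\mathfrak g\times\mathfrak g$ whose projection $U_R$ to the right factor (with Lie algebra $\mathfrak u_R$) is contained in $K$, acting on $G$ by $(u_L,u_R)\cdot g=u_L\,g\,u_R^{-1}$. Assume that the action is free or, more generally, free modulo an ineffective kernel: if $(u_L,u_R)\in U$ fixes a point of $G$, then $u_L=u_R$ lies in the center of $G$. Let $G/\!/U$ be the quotient manifold, with the smooth structure for which $G\to G/\!/U$ is a smooth submersion, and with the metric induced by $\langle\,,\rangle$, i.e. the differential of the projection is isometric on horizontal vectors. For $g\in G$ let $\mathcal V_g=\{\mathrm{Ad}_{g^{-1}}X_L-X_R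 : (X_L,X_R)\in\mathfrak u\}\subset\mathfrak g$ be the tangent space of the orbit through $g$, left translated to $\mathfrak g$; a vector of $\mathfrak g$ is called horizontal at $g$ if it is $\langle\,,\rangle$-perpendicular to $\mathcal V_g$. Theorem. Let $g\in G$. Each of the following conditions implies that there is a $2$-plane of zero sectional curvature in the tangent space of $G/\!/U$ at the point $gU$ (the orbit of $g$): (N1) There are a $P$-invariant abelian subalgebra $\mathfrak a\subset\mathfrak g$ and linearly independent $X,Y\in\mathfrak a$ which are horizontal at $g$. (N2) There are $P$-invariant subspaces $W_1,W_2\subset\mathfrak g$ with $[W_1,W_2]=0$ and linearly independent $X\in W_1$, $Y\in W_2$, both horizontal at $g$, with $[Y,PY]\in W_2$. (N3) There are an $\mathrm{Ad}(K)$-invariant linear subspace $V\subset\mathfrak g$ on which $P$ acts as a scalar (an $\mathrm{Ad}(K)$-invariant eigenspace of $P$, not necessarily the full one) with $V\perp\mathfrak u_R$, and linearly independent $X\in\mathfrak k$, $Y\in V$, both horizontal at $g$, with $[PX,Y]=0$. -/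

import Mathlib

open scoped Manifold ContDiff
open Bundle

noncomputable section

/-! ### Curvature of a Riemannian metric, computed in charts -/

section Curvature

variable {E : Type*} [NormedAddCommGroup E] [NormedSpace ℝ E]

/-- The Christoffel symbols of a (non-constant) metric `b` on a vector space `E`: the vector
`Γ = christoffel b e v w` is characterised by
`b(Γ, z) = 1/2 (∂_v b(w, z) + ∂_w b(v, z) - ∂_z b(v, w))` for all `z`, all at the point `e`. -/
def christoffel (b : E → E →L[ℝ] E →L[ℝ] ℝ) (e v w : E) : E :=
  (1 / 2 : ℝ) • (b e).inverse
    (fderiv ℝ b e v w + fderiv ℝ b e w v - ((fderiv ℝ b e).flip v).flip w)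

/-- The curvature operator `R(u, v) w = ∇_u ∇_v w - ∇_v ∇_u w` at the point `e` (for constant
vector fields `u`, `v`, `w` on the vector space `E`) of the Levi-Civita connection of the
metric `b`. -/
def curvatureOperator (b : E → E →L[ℝ] E →L[ℝ] ℝ) (e u v w : E) : E :=
  fderiv ℝ (fun e' ↦ christoffel b e' v w) e u - fderiv ℝ (fun e' ↦ christoffel b e' u w) e v
    + christoffel b e u (christoffel b e v w) - christoffel b e v (christoffel b e u w)

variable {M : Type*} [TopologicalSpace M] [ChartedSpace E M] [IsManifold 𝓘(ℝ, E) ∞ M]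

/-- A smooth Riemannian metric on a smooth manifold `M` (without boundary). -/
abbrev SmoothMetric (E : Type*) [NormedAddCommGroup E] [NormedSpace ℝ E]
    (M : Type*) [TopologicalSpace M] [ChartedSpace E M] [IsManifold 𝓘(ℝ, E) ∞ M] :=
  ContMDiffRiemannianMetric 𝓘(ℝ, E) ∞ E (fun x : M ↦ TangentSpace 𝓘(ℝ, E) x)

/-- The expression of the Riemannian metric `g` in the preferred chart at `x`. -/
def chartMetric (g : SmoothMetric E M) (x : M) (e : E) : E →L[ℝ] E →L[ℝ] ℝ :=
  let A : E →L[ℝ] TangentSpace 𝓘(ℝ, E) ((extChartAt 𝓘(ℝ, E) x).symm e) :=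
    mfderiv 𝓘(ℝ, E) 𝓘(ℝ, E) (extChartAt 𝓘(ℝ, E) x).symm e
  (ContinuousLinearMap.precomp ℝ A) ∘L (g.inner ((extChartAt 𝓘(ℝ, E) x).symm e)) ∘L A

/-- The sectional curvature `⟨R(u, v) v, u⟩ / (⟨u, u⟩ ⟨v, v⟩ - ⟨u, v⟩ ^ 2)` of the plane spanned by
two linearly independent tangent vectors `u`, `v` at `x`, computed in the preferred chart
at `x`. -/
def sectionalCurvature (g : SmoothMetric E M) (x : M) (u v : TangentSpace 𝓘(ℝ, E) x) : ℝ :=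
  let b := chartMetric g x
  let e : E := extChartAt 𝓘(ℝ, E) x x
  let u' : E := mfderiv 𝓘(ℝ, E) 𝓘(ℝ, E) (extChartAt 𝓘(ℝ, E) x) x u
  let v' : E := mfderiv 𝓘(ℝ, E) 𝓘(ℝ, E) (extChartAt 𝓘(ℝ, E) x) x v
  b e (curvatureOperator b e u' v' v') u' / (b e u' u' * b e v' v' - b e u' v' ^ 2)

/-- There is a plane in the tangent space at `x` with vanishing sectional curvature; the plane is
given by a basis `u`, `v`. -/
def HasZeroCurvaturePlane (g : SmoothMetric E M) (x : M) : Prop :=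
  ∃ u v : TangentSpace 𝓘(ℝ, E) x,
    LinearIndependent ℝ ![u, v] ∧ sectionalCurvature g x u v = 0

end Curvature

/-! ### Invariant metrics on Lie groups -/

section LieGroups

variable {E : Type*} [NormedAddCommGroup E] [NormedSpace ℝ E]
  {G : Type*} [TopologicalSpace G] [ChartedSpace E G] [Group G] [LieGroup 𝓘(ℝ, E) ∞ G]

/-- All left translations are isometries of the Riemannian metric `m`. -/
def IsLeftInvariant (m : SmoothMetric E G) : Prop :=
  ∀ (a h : G) (v w : TangentSpace 𝓘(ℝ, E) h),
    m.inner (a * h) (mfderiv 𝓘(ℝ, E) 𝓘(ℝ, E) (fun x ↦ a * x) h v)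
      (mfderiv 𝓘(ℝ, E) 𝓘(ℝ, E) (fun x ↦ a * x) h w) = m.inner h v w

/-- The right translation by `k` is an isometry of the Riemannian metric `m`. -/
def IsRightIsometry (m : SmoothMetric E G) (k : G) : Prop :=
  ∀ (h : G) (v w : TangentSpace 𝓘(ℝ, E) h),
    m.inner (h * k) (mfderiv 𝓘(ℝ, E) 𝓘(ℝ, E) (fun x ↦ x * k) h v)
      (mfderiv 𝓘(ℝ, E) 𝓘(ℝ, E) (fun x ↦ x * k) h w) = m.inner h v w

/-- The Riemannian metric `m` is invariant under all left and all right translations. -/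
def IsBiInvariant (m : SmoothMetric E G) : Prop :=
  IsLeftInvariant m ∧ ∀ k : G, IsRightIsometry m k

theorem IsRightIsometry.one (m : SmoothMetric E G) : IsRightIsometry m 1 := by
  intro h v w
  have key : ∀ (f : G → G), f = id → ∀ v w : TangentSpace 𝓘(ℝ, E) h,
      m.inner (f h) (mfderiv 𝓘(ℝ, E) 𝓘(ℝ, E) f h v) (mfderiv 𝓘(ℝ, E) 𝓘(ℝ, E) f h w)
        = m.inner h v w := by
    rintro f rfl v w
    rw [mfderiv_id]
    rfl
  exact key (fun x ↦ x * 1) (by ext; simp) v w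

theorem IsRightIsometry.mul {m : SmoothMetric E G} {a b : G} (ha : IsRightIsometry m a)
    (hb : IsRightIsometry m b) : IsRightIsometry m (a * b) := by
  intro h v w
  have key : ∀ (f : G → G), f = (fun x ↦ x * b) ∘ (fun x ↦ x * a) →
      m.inner (f h) (mfderiv 𝓘(ℝ, E) 𝓘(ℝ, E) f h v) (mfderiv 𝓘(ℝ, E) 𝓘(ℝ, E) f h w)
        = m.inner h v w := by
    rintro f rfl
    have d (c y : G) : MDifferentiableAt 𝓘(ℝ, E) 𝓘(ℝ, E) (fun x ↦ x * c) y :=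
      (contMDiff_mul_right (I := 𝓘(ℝ, E)) (n := ∞)).contMDiffAt.mdifferentiableAt (by simp)
    rw [mfderiv_comp h (d b _) (d a h)]
    exact (hb (h * a) _ _).trans (ha h v w)
  exact key (fun x ↦ x * (a * b)) (by ext; simp [mul_assoc])

theorem IsRightIsometry.inv {m : SmoothMetric E G} {a : G} (ha : IsRightIsometry m a) :
    IsRightIsometry m a⁻¹ := by
  intro h v w
  have key : ∀ (f : G → G), f = id →
      m.inner (f h) (mfderiv 𝓘(ℝ, E) 𝓘(ℝ, E) f h v) (mfderiv 𝓘(ℝ, E) 𝓘(ℝ, E) f h w)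
        = m.inner h v w := by
    rintro f rfl
    rw [mfderiv_id]
    rfl
  have d (c y : G) : MDifferentiableAt 𝓘(ℝ, E) 𝓘(ℝ, E) (fun x ↦ x * c) y :=
    (contMDiff_mul_right (I := 𝓘(ℝ, E)) (n := ∞)).contMDiffAt.mdifferentiableAt (by simp)
  have h1 := key ((fun x ↦ x * a) ∘ (fun x ↦ x * a⁻¹)) (by ext; simp)
  rw [mfderiv_comp h (d a _) (d a⁻¹ h)] at h1
  exact (ha (h * a⁻¹) _ _).symm.trans h1

/-- The invariance group `K` of the Riemannian metric `m`: the largest subgroup such that `m` is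
invariant under right translations by its elements. -/
def invarianceGroup (m : SmoothMetric E G) : Subgroup G where
  carrier := {k | IsRightIsometry m k}
  one_mem' := IsRightIsometry.one m
  mul_mem' := IsRightIsometry.mul
  inv_mem' := IsRightIsometry.inv

/-- The adjoint representation `Ad_a : 𝔤 → 𝔤`, the differential at `1` of the conjugation
by `a`. -/
def adjointRep (a : G) : GroupLieAlgebra 𝓘(ℝ, E) G →L[ℝ] GroupLieAlgebra 𝓘(ℝ, E) G :=
  mfderiv 𝓘(ℝ, E) 𝓘(ℝ, E) (fun x : G ↦ a * x * a⁻¹) 1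

/-- `γ` is a smooth one-parameter subgroup of `G` with initial velocity `X`, that is,
`γ t = exp (t X)`. -/
structure IsOneParameterSubgroup (γ : ℝ → G) (X : GroupLieAlgebra 𝓘(ℝ, E) G) : Prop where
  smooth : ContMDiff 𝓘(ℝ, ℝ) 𝓘(ℝ, E) ∞ γ
  map_add : ∀ s t : ℝ, γ (s + t) = γ s * γ t
  velocity : mfderiv 𝓘(ℝ, ℝ) 𝓘(ℝ, E) γ 0 (1 : ℝ) = X

/-- The Lie algebra of a closed subgroup `H` of `G`, as the set of all `X` in the Lie algebra of `G`
with `exp (t X) ∈ H` for all `t`. -/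
def lieAlgebraOf (H : Subgroup G) : Set (GroupLieAlgebra 𝓘(ℝ, E) G) :=
  {X | ∃ γ : ℝ → G, IsOneParameterSubgroup γ X ∧ ∀ t, γ t ∈ H}

/-- The Lie algebra of a closed subgroup `U` of `G × G`, as the set of all pairs `(X_L, X_R)`
with `(exp (t X_L), exp (t X_R)) ∈ U` for all `t`. -/
def lieAlgebraOfProd (U : Subgroup (G × G)) :
    Set (GroupLieAlgebra 𝓘(ℝ, E) G × GroupLieAlgebra 𝓘(ℝ, E) G) :=
  {X | ∃ γL γR : ℝ → G, IsOneParameterSubgroup γL X.1 ∧ IsOneParameterSubgroup γR X.2 ∧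
    ∀ t, (γL t, γR t) ∈ U}

/-! ### Biquotients -/

/-- The projection `U_R` of `U ⊆ G × G` to the right factor. -/
def rightProjection {G : Type*} [Group G] (U : Subgroup (G × G)) : Subgroup G :=
  U.map (MonoidHom.snd G G)

/-- The action `(u_L, u_R) · g = u_L g u_R⁻¹` of `U` on `G` is free modulo an ineffective kernel:
if `(u_L, u_R)` fixes a point then `u_L = u_R` is central (and so acts trivially). This holds in
particular if the action is free. -/
def ActsFreelyModKernel {G : Type*} [Group G] (U : Subgroup (G × G)) : Prop :=
  ∀ u ∈ U, ∀ g : G, u.1 * g * u.2⁻¹ = g → u.1 = u.2 ∧ u.1 ∈ Subgroup.center G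

/-- The orbit relation of the action `(u_L, u_R) · g = u_L g u_R⁻¹` of `U` on `G`. -/
def biquotientSetoid {G : Type*} [Group G] (U : Subgroup (G × G)) : Setoid G where
  r g h := ∃ u ∈ U, u.1 * g * u.2⁻¹ = h
  iseqv :=
    { refl := fun g ↦ ⟨1, U.one_mem, by simp⟩
      symm := by
        rintro g h ⟨u, hu, rfl⟩
        exact ⟨u⁻¹, U.inv_mem hu, by simp [mul_assoc]⟩
      trans := by
        rintro g h k ⟨u, hu, rfl⟩ ⟨u', hu', rfl⟩
        exact ⟨u' * u, U.mul_mem hu' hu, by simp [mul_assoc]⟩ }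

/-- The biquotient `G // U`, the orbit space of the action of `U` on `G`. -/
def Biquotient {G : Type*} [Group G] (U : Subgroup (G × G)) : Type _ :=
  Quotient (biquotientSetoid U)

/-- The biquotient carries the quotient topology. -/
instance {G : Type*} [Group G] [TopologicalSpace G] (U : Subgroup (G × G)) :
    TopologicalSpace (Biquotient U) :=
  inferInstanceAs (TopologicalSpace (Quotient (biquotientSetoid U)))

/-- The projection `G → G // U`. -/
def biquotientProj {G : Type*} [Group G] (U : Subgroup (G × G)) (g : G) : Biquotient U :=
  Quotient.mk (biquotientSetoid U) g

/-- The vertical space at `g`, i.e. the tangent space at `g` of the orbit of `U`, translated to the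
Lie algebra by the left translation by `g⁻¹`. It consists of the vectors `Ad_{g⁻¹} X_L - X_R` with
`(X_L, X_R)` in the Lie algebra of `U` (these already form a linear subspace). -/
def verticalSpace (U : Subgroup (G × G)) (g : G) : Submodule ℝ (GroupLieAlgebra 𝓘(ℝ, E) G) :=
  Submodule.span ℝ {Z | ∃ X ∈ lieAlgebraOfProd (E := E) U, Z = adjointRep g⁻¹ X.1 - X.2}

/-- The left translate to `g` of the vector `X` of the Lie algebra is horizontal: it is
perpendicular to the vertical space at `g`, with respect to the left-invariant metric `m`. -/
def IsHorizontal (m : SmoothMetric E G) (U : Subgroup (G × G)) (g : G)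
    (X : GroupLieAlgebra 𝓘(ℝ, E) G) : Prop :=
  ∀ Z ∈ verticalSpace (E := E) U g, m.inner (1 : G) X Z = 0

section Induced

variable {F : Type*} [NormedAddCommGroup F] [NormedSpace ℝ F]

/-- The smooth structure on the biquotient is the one of the quotient manifold: the projection
`G → G // U` is a smooth submersion. (There is at most one such smooth structure.) -/
def IsQuotientManifold (E : Type*) [NormedAddCommGroup E] [NormedSpace ℝ E]
    (F : Type*) [NormedAddCommGroup F] [NormedSpace ℝ F]
    {G : Type*} [TopologicalSpace G] [ChartedSpace E G] [Group G]
    (U : Subgroup (G × G)) [ChartedSpace F (Biquotient U)] : Prop :=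
  ContMDiff 𝓘(ℝ, E) 𝓘(ℝ, F) ∞ (biquotientProj U) ∧
    ∀ g : G, Function.Surjective (mfderiv 𝓘(ℝ, E) 𝓘(ℝ, F) (biquotientProj U) g)

/-- The metric `mB` on the biquotient is induced by the left-invariant metric `m` on `G`: the
differential of the projection `G → G // U` is isometric on horizontal vectors. -/
def IsInducedMetric (m : SmoothMetric E G) (U : Subgroup (G × G))
    [ChartedSpace F (Biquotient U)] [IsManifold 𝓘(ℝ, F) ∞ (Biquotient U)]
    (mB : SmoothMetric F (Biquotient U)) : Prop :=
  ∀ (g : G) (X Y : GroupLieAlgebra 𝓘(ℝ, E) G), IsHorizontal m U g X → IsHorizontal m U g Y →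
    mB.inner (biquotientProj U g)
      (mfderiv 𝓘(ℝ, E) 𝓘(ℝ, F) (biquotientProj U) g (mulInvariantVectorField X g))
      (mfderiv 𝓘(ℝ, E) 𝓘(ℝ, F) (biquotientProj U) g (mulInvariantVectorField Y g))
    = m.inner (1 : G) X Y

end Induced

end LieGroups

end

set_option maxSynthPendingDepth 3

section FramedConnection

open Filter Topology VectorField

variable {E V : Type*} [NormedAddCommGroup E] [NormedSpace ℝ E]
  [NormedAddCommGroup V] [NormedSpace ℝ V]

/-- The covariant derivative of the section `s`, where `V` is the fibre of a vector bundle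
trivialised over `E`, `L` identifies `V` with the tangent spaces of `E`, and `Λ` is the connection
form. -/
noncomputable def framedNabla (L : E → V →L[ℝ] E) (Λ : E → V →L[ℝ] V →L[ℝ] V) (s : E → V) (p : E) :
    V →L[ℝ] V :=
  fderiv ℝ s p ∘L L p + (Λ p).flip (s p)

theorem framedNabla_apply (L : E → V →L[ℝ] E) (Λ : E → V →L[ℝ] V →L[ℝ] V) (s : E → V) (p : E)
    (A : V) : framedNabla L Λ s p A = fderiv ℝ s p (L p A) + Λ p A (s p) := rfl

/-- The curvature of a connection, in the frame `L` with structure functions `β`. -/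
noncomputable def framedCurvature (L : E → V →L[ℝ] E) (β : V → V → V)
    (Λ : E → V →L[ℝ] V →L[ℝ] V) (e : E) (A B C : V) : V :=
  fderiv ℝ Λ e (L e A) B C - fderiv ℝ Λ e (L e B) A C + Λ e A (Λ e B C) - Λ e B (Λ e A C)
    - Λ e (β A B) C

/-- `Λ` is the Levi-Civita connection of the metric `b`, in the frame `L` with structure
functions `β`, near the point `e`. -/
structure IsFramedLeviCivita (e : E) (L : E → V →L[ℝ] E) (β : V → V → V)
    (b : E → V →L[ℝ] V →L[ℝ] ℝ) (Λ : E → V →L[ℝ] V →L[ℝ] V) : Prop where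
  contDiffAt_frame : ContDiffAt ℝ 2 L e
  contDiffAt_metric : ContDiffAt ℝ 2 b e
  contDiffAt_connection : ContDiffAt ℝ 1 Λ e
  lieBracket_frame : ∀ᶠ p in 𝓝 e, ∀ A B,
    lieBracket ℝ (fun q ↦ L q A) (fun q ↦ L q B) p = L p (β A B)
  symm : ∀ᶠ p in 𝓝 e, ∀ v w, b p v w = b p w v
  compat : ∀ᶠ p in 𝓝 e, ∀ A v w,
    fderiv ℝ b p (L p A) v w = b p (Λ p A v) w + b p v (Λ p A w)
  torsion : ∀ᶠ p in 𝓝 e, ∀ A B, Λ p A B - Λ p B A = β A B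

namespace IsFramedLeviCivita

variable {e : E} {L : E → V →L[ℝ] E} {β : V → V → V} {b : E → V →L[ℝ] V →L[ℝ] ℝ}
  {Λ : E → V →L[ℝ] V →L[ℝ] V} {X Y Z s t : E → V}

/-- The vector field `X` has a symmetric covariant derivative, as gradient fields do. -/
def IsGradientAt (L : E → V →L[ℝ] E) (b : E → V →L[ℝ] V →L[ℝ] ℝ) (Λ : E → V →L[ℝ] V →L[ℝ] V)
    (X : E → V) (p : E) : Prop :=
  ∀ A C, b p (framedNabla L Λ X p A) C = b p (framedNabla L Λ X p C) A

theorem eventually_differentiableAt {W : Type*} [NormedAddCommGroup W] [NormedSpace ℝ W]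
    {f : E → W} (hf : ContDiffAt ℝ 2 f e) : ∀ᶠ p in 𝓝 e, DifferentiableAt ℝ f p := by
  filter_upwards [hf.eventually (by simp)] with p hp
  exact hp.differentiableAt (by simp)

theorem fderiv_metric (hs : DifferentiableAt ℝ s e) (ht : DifferentiableAt ℝ t e)
    (hb : DifferentiableAt ℝ b e) (u : E) :
    fderiv ℝ (fun q ↦ b q (s q) (t q)) e u
      = fderiv ℝ b e u (s e) (t e) + b e (fderiv ℝ s e u) (t e) + b e (s e) (fderiv ℝ t e u) := by
  have := ((hb.hasFDerivAt.clm_apply hs.hasFDerivAt).clm_apply ht.hasFDerivAt).fderiv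
  rw [this]
  simp
  ring

theorem fderiv_metric_frame (h : IsFramedLeviCivita e L β b Λ) (hs : ContDiffAt ℝ 2 s e)
    (ht : ContDiffAt ℝ 2 t e) : ∀ᶠ p in 𝓝 e, ∀ A,
      fderiv ℝ (fun q ↦ b q (s q) (t q)) p (L p A)
        = b p (framedNabla L Λ s p A) (t p) + b p (s p) (framedNabla L Λ t p A) := by
  filter_upwards [h.compat, eventually_differentiableAt hs, eventually_differentiableAt ht,
    eventually_differentiableAt h.contDiffAt_metric] with p hc hs ht hb A
  rw [fderiv_metric hs ht hb, hc]
  simp only [framedNabla_apply, map_add, add_apply]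
  ring

/-- A vector field dual to a closed form has a symmetric covariant derivative. -/
theorem isGradientAt (h : IsFramedLeviCivita e L β b Λ) (hX : ContDiffAt ℝ 2 X e)
    (hclosed : ∀ᶠ p in 𝓝 e, ∀ A C, fderiv ℝ (fun q ↦ b q (X q) C) p (L p A)
      - fderiv ℝ (fun q ↦ b q (X q) A) p (L p C) = b p (X p) (β A C)) :
    ∀ᶠ p in 𝓝 e, IsGradientAt L b Λ X p := by
  filter_upwards [h.compat, h.torsion, eventually_differentiableAt hX,
    eventually_differentiableAt h.contDiffAt_metric, hclosed] with p hc ht hX hb hcl A C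
  have h1 := hcl A C
  rw [fderiv_metric hX (differentiableAt_const C) hb, fderiv_metric hX (differentiableAt_const A) hb,
    hc, hc, ← ht] at h1
  simp only [fderiv_fun_const, Pi.zero_apply, zero_apply, map_zero,
    map_sub] at h1
  simp only [framedNabla_apply, map_add, add_apply]
  linarith

/-- The Koszul formula for fields with symmetric covariant derivatives. -/
theorem koszul (h : IsFramedLeviCivita e L β b Λ) (hX : ContDiffAt ℝ 2 X e)
    (hY : ContDiffAt ℝ 2 Y e) (hZ : ContDiffAt ℝ 2 Z e)
    (gX : ∀ᶠ p in 𝓝 e, IsGradientAt L b Λ X p) (gY : ∀ᶠ p in 𝓝 e, IsGradientAt L b Λ Y p)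
    (gZ : ∀ᶠ p in 𝓝 e, IsGradientAt L b Λ Z p) :
    ∀ᶠ p in 𝓝 e, b p (framedNabla L Λ Y p (X p)) (Z p)
      = (fderiv ℝ (fun q ↦ b q (Y q) (Z q)) p (L p (X p))
        + fderiv ℝ (fun q ↦ b q (X q) (Y q)) p (L p (Z p))
        - fderiv ℝ (fun q ↦ b q (X q) (Z q)) p (L p (Y p))) / 2 := by
  filter_upwards [h.symm, gX, gY, gZ, h.fderiv_metric_frame hY hZ, h.fderiv_metric_frame hX hY,
    h.fderiv_metric_frame hX hZ] with p hs gX gY gZ h1 h2 h3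
  rw [h1, h2, h3, hs (X p), hs (Y p), hs (X p), gX (Z p) (Y p), gY (Z p) (X p), gZ (X p) (Y p)]
  ring

theorem contDiffAt_framedNabla_apply (h : IsFramedLeviCivita e L β b Λ) (hX : ContDiffAt ℝ 2 X e)
    (hs : ContDiffAt ℝ 2 s e) : ContDiffAt ℝ 1 (fun p ↦ framedNabla L Λ s p (X p)) e := by
  have h1 : ContDiffAt ℝ 1 (fderiv ℝ s) e := hs.fderiv_right (by norm_num)
  have h2 : ContDiffAt ℝ 1 X e := hX.of_le (by norm_num)
  exact (h1.clm_apply ((h.contDiffAt_frame.of_le (by norm_num)).clm_apply h2)).add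
    ((h.contDiffAt_connection.clm_apply h2).clm_apply (hs.of_le (by norm_num)))

theorem fderiv_framedNabla_apply (h : IsFramedLeviCivita e L β b Λ) (hX : ContDiffAt ℝ 2 X e)
    (hs : ContDiffAt ℝ 2 s e) (u : E) :
    fderiv ℝ (fun p ↦ framedNabla L Λ s p (X p)) e u
      = fderiv ℝ (fderiv ℝ s) e u (L e (X e)) + fderiv ℝ s e (fderiv ℝ L e u (X e))
        + fderiv ℝ s e (L e (fderiv ℝ X e u)) + fderiv ℝ Λ e u (X e) (s e)
        + Λ e (fderiv ℝ X e u) (s e) + Λ e (X e) (fderiv ℝ s e u) := by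
  have h1 : ContDiffAt ℝ 1 (fderiv ℝ s) e := hs.fderiv_right (by norm_num)
  have d1 := (h1.differentiableAt (by simp)).hasFDerivAt
  have dX := (hX.differentiableAt (by simp)).hasFDerivAt
  have ds := (hs.differentiableAt (by simp)).hasFDerivAt
  have dL := (h.contDiffAt_frame.differentiableAt (by simp)).hasFDerivAt
  have dΛ := (h.contDiffAt_connection.differentiableAt (by simp)).hasFDerivAt
  have := ((d1.clm_apply (dL.clm_apply dX)).add ((dΛ.clm_apply dX).clm_apply ds)).fderiv
  simp only [framedNabla_apply]
  refine (congrArg (fun T : E →L[ℝ] V ↦ T u) this).trans ?_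
  simp
  abel

/-- The Ricci identity. -/
theorem nabla_nabla_sub (h : IsFramedLeviCivita e L β b Λ) (hX : ContDiffAt ℝ 2 X e)
    (hY : ContDiffAt ℝ 2 Y e) (hs : ContDiffAt ℝ 2 s e) :
    framedNabla L Λ (fun p ↦ framedNabla L Λ s p (Y p)) e (X e)
      - framedNabla L Λ (fun p ↦ framedNabla L Λ s p (X p)) e (Y e)
      - framedNabla L Λ s e (framedNabla L Λ Y e (X e) - framedNabla L Λ X e (Y e))
    = framedCurvature L β Λ e (X e) (Y e) (s e) := by
  have hsymm : fderiv ℝ (fderiv ℝ s) e (L e (X e)) (L e (Y e))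
      = fderiv ℝ (fderiv ℝ s) e (L e (Y e)) (L e (X e)) :=
    (hs.isSymmSndFDerivAt (by simp)).eq _ _
  have dL := (h.contDiffAt_frame.differentiableAt (by simp)).hasFDerivAt
  have dLc (A u : _) : fderiv ℝ (fun q ↦ L q A) e u = fderiv ℝ L e u A := by
    rw [(dL.clm_apply (hasFDerivAt_const A e)).fderiv]
    simp
  have hbr : fderiv ℝ L e (L e (X e)) (Y e) - fderiv ℝ L e (L e (Y e)) (X e)
      = L e (β (X e) (Y e)) := by
    rw [← h.lieBracket_frame.self_of_nhds, lieBracket_eq]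
    simp [dLc]
  have ht := h.torsion.self_of_nhds (X e) (Y e)
  have h1 : fderiv ℝ s e (fderiv ℝ L e (L e (X e)) (Y e))
      = fderiv ℝ s e (fderiv ℝ L e (L e (Y e)) (X e)) + fderiv ℝ s e (L e (β (X e) (Y e))) := by
    rw [← hbr, ← map_add]
    simp
  have h2 : framedNabla L Λ Y e (X e) - framedNabla L Λ X e (Y e)
      = fderiv ℝ Y e (L e (X e)) - fderiv ℝ X e (L e (Y e)) + β (X e) (Y e) := by
    rw [← ht, framedNabla_apply, framedNabla_apply]
    abel
  rw [h2]
  rw [framedNabla_apply _ _ (fun p ↦ framedNabla L Λ s p (Y p)),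
    framedNabla_apply _ _ (fun p ↦ framedNabla L Λ s p (X p)), h.fderiv_framedNabla_apply hY hs,
    h.fderiv_framedNabla_apply hX hs, hsymm, h1]
  simp only [framedNabla_apply, framedCurvature, map_add, map_sub]
  abel

/-- The sectional curvature in terms of vector fields with symmetric covariant derivatives. -/
theorem metric_curvature (h : IsFramedLeviCivita e L β b Λ) (hX : ContDiffAt ℝ 2 X e)
    (hY : ContDiffAt ℝ 2 Y e)
    (gX : ∀ᶠ p in 𝓝 e, IsGradientAt L b Λ X p) (gY : ∀ᶠ p in 𝓝 e, IsGradientAt L b Λ Y p) :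
    b e (framedCurvature L β Λ e (X e) (Y e) (Y e)) (X e)
      = fderiv ℝ (fun p ↦ fderiv ℝ (fun q ↦ b q (Y q) (Y q)) p (L p (X p)) / 2) e (L e (X e))
        - fderiv ℝ (fun p ↦ fderiv ℝ (fun q ↦ b q (Y q) (X q)) p (L p (X p))
          - fderiv ℝ (fun q ↦ b q (X q) (X q)) p (L p (Y p)) / 2) e (L e (Y e))
        - b e (framedNabla L Λ Y e (Y e)) (framedNabla L Λ X e (X e))
        + 2 * b e (framedNabla L Λ Y e (X e)) (framedNabla L Λ X e (Y e))
        - b e (framedNabla L Λ Y e (X e)) (framedNabla L Λ Y e (X e)) := by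
  have c1 : ∀ {f : E → V}, ContDiffAt ℝ 1 f e → DifferentiableAt ℝ f e :=
    fun hf ↦ hf.differentiableAt (by simp)
  have db := h.contDiffAt_metric.differentiableAt (by simp)
  have dX := hX.differentiableAt (by simp)
  have key : ∀ {f : E → V}, DifferentiableAt ℝ f e → ∀ A,
      b e (framedNabla L Λ f e A) (X e) = fderiv ℝ (fun q ↦ b q (f q) (X q)) e (L e A)
        - b e (f e) (framedNabla L Λ X e A) := by
    intro f hf A
    rw [fderiv_metric hf dX db, h.compat.self_of_nhds]
    simp only [framedNabla_apply, map_add, add_apply]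
    ring
  have k1 : (fun p ↦ b p (framedNabla L Λ Y p (Y p)) (X p)) =ᶠ[𝓝 e]
      fun p ↦ fderiv ℝ (fun q ↦ b q (Y q) (Y q)) p (L p (X p)) / 2 := by
    filter_upwards [h.koszul hY hY hX gY gY gX] with p hp
    rw [hp]
    ring
  have k2 : (fun p ↦ b p (framedNabla L Λ Y p (X p)) (X p)) =ᶠ[𝓝 e]
      fun p ↦ fderiv ℝ (fun q ↦ b q (Y q) (X q)) p (L p (X p))
          - fderiv ℝ (fun q ↦ b q (X q) (X q)) p (L p (Y p)) / 2 := by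
    filter_upwards [h.koszul hX hY hX gX gY gX, h.symm.eventually_nhds] with p hp hs
    have : (fun q ↦ b q (X q) (Y q)) =ᶠ[𝓝 p] fun q ↦ b q (Y q) (X q) := by
      filter_upwards [hs] with q hq using hq _ _
    rw [hp, this.fderiv_eq]
    ring
  have t1 := key (c1 (h.contDiffAt_framedNabla_apply hY hY)) (X e)
  have t2 := key (c1 (h.contDiffAt_framedNabla_apply hX hY)) (Y e)
  have t3 := gY.self_of_nhds (framedNabla L Λ Y e (X e) - framedNabla L Λ X e (Y e)) (X e)
  rw [k1.fderiv_eq] at t1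
  rw [k2.fderiv_eq] at t2
  rw [← h.nabla_nabla_sub hX hY hY, map_sub, map_sub, sub_apply, sub_apply, t1, t2, t3, map_sub]
  ring

end IsFramedLeviCivita

end FramedConnection

section Submersion

open Filter Topology VectorField

theorem isInvertible_of_pos {V : Type*} [NormedAddCommGroup V] [NormedSpace ℝ V]
    [FiniteDimensional ℝ V] {m : V →L[ℝ] V →L[ℝ] ℝ} (hm : ∀ v, v ≠ 0 → 0 < m v v) :
    m.IsInvertible := by
  have hinj : Function.Injective m.toLinearMap := by
    rw [← LinearMap.ker_eq_bot, LinearMap.ker_eq_bot']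
    intro v hv
    by_contra hne
    have h1 := hm v hne
    have h2 : m v = 0 := hv
    simp [h2] at h1
  have hd : Module.finrank ℝ V = Module.finrank ℝ (V →L[ℝ] ℝ) := by
    rw [← (LinearMap.toContinuousLinearMap (𝕜 := ℝ) (E := V) (F' := ℝ)).finrank_eq]
    exact (Subspace.dual_finrank_eq (K := ℝ) (V := V)).symm
  exact ⟨(LinearEquiv.ofInjectiveOfFinrankEq m.toLinearMap hinj hd).toContinuousLinearEquiv,
    by ext; rfl⟩

/-- The Christoffel symbols of a metric on a vector space, as a bilinear map. -/
noncomputable def christoffelL {F : Type*} [NormedAddCommGroup F] [NormedSpace ℝ F]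
    (b : F → F →L[ℝ] F →L[ℝ] ℝ) (q : F) : F →L[ℝ] F →L[ℝ] F :=
  (1 / 2 : ℝ) • (ContinuousLinearMap.compL ℝ F (F →L[ℝ] ℝ) F (b q).inverse ∘L
    (fderiv ℝ b q + (fderiv ℝ b q).flip
      - (ContinuousLinearMap.flipₗᵢ ℝ F F ℝ).toContinuousLinearEquiv.toContinuousLinearMap ∘L (fderiv ℝ b q).flip))

theorem christoffelL_apply {F : Type*} [NormedAddCommGroup F] [NormedSpace ℝ F]
    (b : F → F →L[ℝ] F →L[ℝ] ℝ) (q v w : F) : christoffelL b q v w = christoffel b q v w := by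
  simp [christoffelL, christoffel]

section Target

variable {F : Type*} [NormedAddCommGroup F] [NormedSpace ℝ F] [FiniteDimensional ℝ F]
  {b : F → F →L[ℝ] F →L[ℝ] ℝ} {q : F}

theorem contDiffAt_inverse_metric (hb : ContDiffAt ℝ ∞ b q) (hinv : ∀ᶠ p in 𝓝 q, (b p).IsInvertible) :
    ContDiffAt ℝ ∞ (fun p ↦ (b p).inverse) q :=
  have := FiniteDimensional.complete ℝ F
  (hinv.self_of_nhds.contDiffAt_map_inverse).comp q hb

theorem fderiv_metric_symm (hd : DifferentiableAt ℝ b q)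
    (hs : ∀ᶠ p in 𝓝 q, ∀ v w, b p v w = b p w v) (u v w : F) :
    fderiv ℝ b q u v w = fderiv ℝ b q u w v := by
  have key (v w : F) : fderiv ℝ (fun p ↦ b p v w) q u = fderiv ℝ b q u v w := by
    rw [IsFramedLeviCivita.fderiv_metric (differentiableAt_const v) (differentiableAt_const w) hd]
    simp
  rw [← key, ← key]
  have : (fun p ↦ b p v w) =ᶠ[𝓝 q] fun p ↦ b p w v := by
    filter_upwards [hs] with p hp using hp v w
  rw [this.fderiv_eq]

theorem isFramedLeviCivita_christoffel (hb : ContDiffAt ℝ ∞ b q)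
    (hinv : ∀ᶠ p in 𝓝 q, (b p).IsInvertible) (hsymm : ∀ᶠ p in 𝓝 q, ∀ v w, b p v w = b p w v) :
    IsFramedLeviCivita q (fun _ ↦ ContinuousLinearMap.id ℝ F) (fun _ _ ↦ 0) b (christoffelL b) where
  contDiffAt_frame := contDiffAt_const
  contDiffAt_metric := hb.of_le ENat.LEInfty.out
  contDiffAt_connection := by
    have h1 : ContDiffAt ℝ 1 (fun p ↦ (b p).inverse) q :=
      (contDiffAt_inverse_metric hb hinv).of_le ENat.LEInfty.out
    have h2 : ContDiffAt ℝ 1 (fderiv ℝ b) q :=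
      hb.fderiv_right (m := 1) (by norm_cast)
    have h3 : ContDiffAt ℝ 1 (fun p ↦ (fderiv ℝ b p).flip) q :=
      (ContinuousLinearMap.flipₗᵢ ℝ F F (F →L[ℝ] ℝ)).contDiff.contDiffAt.comp q h2
    have h4 : ContDiffAt ℝ 1 (fun p ↦ ContinuousLinearMap.compL ℝ F (F →L[ℝ] ℝ) F (b p).inverse) q :=
      (ContinuousLinearMap.compL ℝ F (F →L[ℝ] ℝ) F).contDiff.contDiffAt.comp q h1
    unfold christoffelL
    exact ContDiffAt.const_smul _ (h4.clm_comp ((h2.add h3).sub (contDiffAt_const.clm_comp h3)))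
  lieBracket_frame := by
    refine Eventually.of_forall fun p A B ↦ ?_
    simp [lieBracket_eq]
  symm := hsymm
  compat := by
    filter_upwards [hinv, hsymm.eventually_nhds,
      IsFramedLeviCivita.eventually_differentiableAt (hb.of_le ENat.LEInfty.out)]
      with p hi hs hd A v w
    have hds := fderiv_metric_symm hd hs
    have key (v w z : F) : b p (christoffel b p v w) z
        = (fderiv ℝ b p v w z + fderiv ℝ b p w v z - fderiv ℝ b p z v w) / 2 := by
      rw [christoffel, map_smul, hi.self_apply_inverse]
      simp
      ring
    rw [christoffelL_apply, christoffelL_apply, hs.self_of_nhds v, key, key, hds A w v]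
    simp
    ring
  torsion := by
    filter_upwards [hsymm.eventually_nhds,
      IsFramedLeviCivita.eventually_differentiableAt (hb.of_le ENat.LEInfty.out)]
      with p hs hd A v
    have hds := fderiv_metric_symm hd hs
    have : ((fderiv ℝ b p).flip v).flip A = ((fderiv ℝ b p).flip A).flip v := by
      ext z
      exact hds z v A
    rw [christoffelL_apply, christoffelL_apply, christoffel, christoffel, this,
      add_comm (fderiv ℝ b p v A), sub_self]

theorem curvatureOperator_eq (hb : ContDiffAt ℝ ∞ b q)
    (hinv : ∀ᶠ p in 𝓝 q, (b p).IsInvertible) (hsymm : ∀ᶠ p in 𝓝 q, ∀ v w, b p v w = b p w v)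
    (u v w : F) : curvatureOperator b q u v w
      = framedCurvature (fun _ ↦ ContinuousLinearMap.id ℝ F) (fun _ _ ↦ 0) (christoffelL b) q u v w := by
  have h := ((isFramedLeviCivita_christoffel hb hinv hsymm).contDiffAt_connection.differentiableAt
    (by simp)).hasFDerivAt
  have key (v w u : F) : fderiv ℝ (fun p ↦ christoffel b p v w) q u
      = fderiv ℝ (christoffelL b) q u v w := by
    simp only [← christoffelL_apply]
    rw [((h.clm_apply (hasFDerivAt_const v q)).clm_apply (hasFDerivAt_const w q)).fderiv]
    simp
  rw [curvatureOperator, framedCurvature, key, key]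
  simp [christoffelL_apply]

/-- Vector fields dual to constant covectors have symmetric covariant derivatives. -/
theorem isGradientAt_inverse_metric (hb : ContDiffAt ℝ ∞ b q)
    (hinv : ∀ᶠ p in 𝓝 q, (b p).IsInvertible) (hsymm : ∀ᶠ p in 𝓝 q, ∀ v w, b p v w = b p w v)
    (η : F →L[ℝ] ℝ) : ∀ᶠ p in 𝓝 q, IsFramedLeviCivita.IsGradientAt
      (fun _ ↦ ContinuousLinearMap.id ℝ F) b (christoffelL b) (fun p ↦ (b p).inverse η) p := by
  refine (isFramedLeviCivita_christoffel hb hinv hsymm).isGradientAt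
    (((contDiffAt_inverse_metric hb hinv).of_le ENat.LEInfty.out).clm_apply
      contDiffAt_const) ?_
  filter_upwards [hinv.eventually_nhds] with p hp A C
  have key (C : F) : (fun p ↦ b p ((b p).inverse η) C) =ᶠ[𝓝 p] fun _ ↦ η C := by
    filter_upwards [hp] with r hr
    rw [hr.self_apply_inverse]
  rw [(key C).fderiv_eq, (key A).fderiv_eq]
  simp

end Target

end Submersion

section Submersion

open Filter Topology VectorField

variable {E V F : Type*} [NormedAddCommGroup E] [NormedSpace ℝ E]
  [NormedAddCommGroup V] [NormedSpace ℝ V] [NormedAddCommGroup F] [NormedSpace ℝ F]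

/-- The gradient, in the frame `L` and with respect to the metric `m`, of the function `η ∘ Φ`. -/
noncomputable def gradientLift (m : V →L[ℝ] V →L[ℝ] ℝ) (L : E → V →L[ℝ] E) (Φ : E → F)
    (η : F →L[ℝ] ℝ) (p : E) : V :=
  m.inverse (η ∘L fderiv ℝ Φ p ∘L L p)

variable {m : V →L[ℝ] V →L[ℝ] ℝ} {L : E → V →L[ℝ] E} {β : V → V → V} {Λ : V →L[ℝ] V →L[ℝ] V}
  {Φ : E → F} {e : E} {b : F → F →L[ℝ] F →L[ℝ] ℝ}

theorem gradientLift_apply (hm : m.IsInvertible) (η : F →L[ℝ] ℝ) (p : E) (A : V) :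
    m (gradientLift m L Φ η p) A = η (fderiv ℝ Φ p (L p A)) := by
  rw [gradientLift, hm.self_apply_inverse]
  rfl

theorem contDiffAt_gradientLift (hL : ContDiffAt ℝ 2 L e) (hΦ : ContDiffAt ℝ ∞ Φ e)
    (η : F →L[ℝ] ℝ) : ContDiffAt ℝ 2 (gradientLift m L Φ η) e := by
  have h1 : ContDiffAt ℝ 2 (fderiv ℝ Φ) e := hΦ.fderiv_right (m := 2) (by norm_cast)
  exact contDiffAt_const.clm_apply (contDiffAt_const.clm_comp (h1.clm_comp hL))

theorem isGradientAt_gradientLift (hm : m.IsInvertible)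
    (h : IsFramedLeviCivita e L β (fun _ ↦ m) (fun _ ↦ Λ)) (hΦ : ContDiffAt ℝ ∞ Φ e)
    (η : F →L[ℝ] ℝ) : ∀ᶠ p in 𝓝 e,
      IsFramedLeviCivita.IsGradientAt L (fun _ ↦ m) (fun _ ↦ Λ) (gradientLift m L Φ η) p := by
  have hΦ3 : ContDiffAt ℝ 3 Φ e := hΦ.of_le ENat.LEInfty.out
  refine h.isGradientAt (contDiffAt_gradientLift h.contDiffAt_frame hΦ η) ?_
  filter_upwards [h.lieBracket_frame, hΦ3.eventually (by simp),
    IsFramedLeviCivita.eventually_differentiableAt h.contDiffAt_frame] with p hbr hΦ3 hL A C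
  simp only [gradientLift_apply hm]
  have d2 : HasFDerivAt (fderiv ℝ Φ) (fderiv ℝ (fderiv ℝ Φ) p) p :=
    ((hΦ3.fderiv_right (m := 1) (by norm_num)).differentiableAt (by simp)).hasFDerivAt
  have dL (C : V) : HasFDerivAt (fun q ↦ L q C) (fderiv ℝ (fun q ↦ L q C) p) p :=
    (hL.clm_apply (differentiableAt_const C)).hasFDerivAt
  have key (C : V) (u : E) : fderiv ℝ (fun q ↦ η (fderiv ℝ Φ q (L q C))) p u
      = η (fderiv ℝ (fderiv ℝ Φ) p u (L p C)) + η (fderiv ℝ Φ p (fderiv ℝ (fun q ↦ L q C) p u)) := by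
    refine (congrArg (fun T : E →L[ℝ] ℝ ↦ T u)
      (η.hasFDerivAt.comp p (d2.clm_apply (dL C))).fderiv).trans ?_
    simp
    ring
  have hs : fderiv ℝ (fderiv ℝ Φ) p (L p A) (L p C) = fderiv ℝ (fderiv ℝ Φ) p (L p C) (L p A) :=
    (hΦ3.isSymmSndFDerivAt (by simp; norm_num)).eq _ _
  rw [key, key, hs, ← hbr, lieBracket_eq, map_sub, map_sub]
  ring

/-- Derivatives along related vector fields of a function pulled back by `Φ`. -/
theorem fderiv_comp_eventuallyEq {X : E → V} {x : F → F} {f : E → ℝ} {k : F → ℝ}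
    (hΦ : ContDiffAt ℝ ∞ Φ e) (hk : ContDiffAt ℝ 1 k (Φ e)) (hf : f =ᶠ[𝓝 e] k ∘ Φ)
    (hX : ∀ᶠ p in 𝓝 e, fderiv ℝ Φ p (L p (X p)) = x (Φ p)) :
    (fun p ↦ fderiv ℝ f p (L p (X p))) =ᶠ[𝓝 e] (fun q ↦ fderiv ℝ k q (x q)) ∘ Φ := by
  have hk' : ∀ᶠ p in 𝓝 e, DifferentiableAt ℝ k (Φ p) :=
    hΦ.continuousAt.eventually ((hk.eventually (by simp)).mono
      fun q hq ↦ hq.differentiableAt (by simp))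
  filter_upwards [hf.eventually_nhds, hX, hk',
    IsFramedLeviCivita.eventually_differentiableAt (hΦ.of_le ENat.LEInfty.out)] with p hf hX hk hΦ
  have hf : f =ᶠ[𝓝 p] k ∘ Φ := hf
  rw [hf.fderiv_eq, fderiv_comp p hk hΦ]
  simp [hX]

variable [FiniteDimensional ℝ F]

/-- The data of a Riemannian submersion from a framed space with a constant metric. -/
structure IsFramedSubmersion (m : V →L[ℝ] V →L[ℝ] ℝ) (L : E → V →L[ℝ] E) (Φ : E → F) (e : E)
    (b : F → F →L[ℝ] F →L[ℝ] ℝ) : Prop where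
  contDiffAt : ContDiffAt ℝ ∞ Φ e
  contDiffAt_metric : ContDiffAt ℝ ∞ b (Φ e)
  isInvertible : ∀ᶠ q in 𝓝 (Φ e), (b q).IsInvertible
  symm : ∀ᶠ q in 𝓝 (Φ e), ∀ v w, b q v w = b q w v
  surjective : ∀ᶠ p in 𝓝 e, Function.Surjective (fun A ↦ fderiv ℝ Φ p (L p A))
  isometry : ∀ᶠ p in 𝓝 e, ∀ X, (∀ Z, fderiv ℝ Φ p (L p Z) = 0 → m X Z = 0) →
    ∀ A, b (Φ p) (fderiv ℝ Φ p (L p X)) (fderiv ℝ Φ p (L p A)) = m X A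

namespace IsFramedSubmersion

theorem gradientLift_related (h : IsFramedSubmersion m L Φ e b) (hm : m.IsInvertible)
    (η : F →L[ℝ] ℝ) :
    ∀ᶠ p in 𝓝 e, fderiv ℝ Φ p (L p (gradientLift m L Φ η p)) = (b (Φ p)).inverse η := by
  filter_upwards [h.surjective, h.isometry,
    h.contDiffAt.continuousAt.eventually h.isInvertible] with p hs hi hb
  have h1 := hi (gradientLift m L Φ η p) fun Z hZ ↦ by rw [gradientLift_apply hm, hZ, map_zero]
  have h2 : b (Φ p) (fderiv ℝ Φ p (L p (gradientLift m L Φ η p))) = η := by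
    ext v
    obtain ⟨A, rfl⟩ := hs v
    exact (h1 A).trans (gradientLift_apply hm η p A)
  rw [← h2, hb.inverse_apply_self, h2]

theorem metric_gradientLift (h : IsFramedSubmersion m L Φ e b) (hm : m.IsInvertible)
    (η ζ : F →L[ℝ] ℝ) :
    (fun p ↦ m (gradientLift m L Φ η p) (gradientLift m L Φ ζ p)) =ᶠ[𝓝 e]
      (fun q ↦ b q ((b q).inverse η) ((b q).inverse ζ)) ∘ Φ := by
  filter_upwards [h.gradientLift_related hm ζ,
    h.contDiffAt.continuousAt.eventually h.isInvertible] with p hp hb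
  rw [gradientLift_apply hm, hp, Function.comp_apply, hb.self_apply_inverse]

theorem contDiffAt_inverse_apply (h : IsFramedSubmersion m L Φ e b) (η : F →L[ℝ] ℝ) :
    ContDiffAt ℝ ∞ (fun q ↦ (b q).inverse η) (Φ e) :=
  (contDiffAt_inverse_metric h.contDiffAt_metric h.isInvertible).clm_apply contDiffAt_const

theorem contDiffAt_metric_inverse (h : IsFramedSubmersion m L Φ e b) (η ζ : F →L[ℝ] ℝ) :
    ContDiffAt ℝ ∞ (fun q ↦ b q ((b q).inverse η) ((b q).inverse ζ)) (Φ e) :=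
  (h.contDiffAt_metric.clm_apply (h.contDiffAt_inverse_apply η)).clm_apply
    (h.contDiffAt_inverse_apply ζ)

theorem fderiv_metric_gradientLift (h : IsFramedSubmersion m L Φ e b) (hm : m.IsInvertible)
    (η ζ κ : F →L[ℝ] ℝ) :
    (fun p ↦ fderiv ℝ (fun p ↦ m (gradientLift m L Φ η p) (gradientLift m L Φ ζ p)) p
      (L p (gradientLift m L Φ κ p))) =ᶠ[𝓝 e]
    (fun q ↦ fderiv ℝ (fun q ↦ b q ((b q).inverse η) ((b q).inverse ζ)) q ((b q).inverse κ)) ∘ Φ :=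
  fderiv_comp_eventuallyEq h.contDiffAt ((h.contDiffAt_metric_inverse η ζ).of_le ENat.LEInfty.out)
    (h.metric_gradientLift hm η ζ) (h.gradientLift_related hm κ)

theorem contDiffAt_fderiv_metric (h : IsFramedSubmersion m L Φ e b) (η ζ κ : F →L[ℝ] ℝ) :
    ContDiffAt ℝ 1 (fun q ↦ fderiv ℝ (fun q ↦ b q ((b q).inverse η) ((b q).inverse ζ)) q
      ((b q).inverse κ)) (Φ e) :=
  ((h.contDiffAt_metric_inverse η ζ).fderiv_right (m := 1) (by norm_cast)).clm_apply
    ((h.contDiffAt_inverse_apply κ).of_le ENat.LEInfty.out)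

theorem fderiv_framedNabla (h : IsFramedSubmersion m L Φ e b) (hm : m.IsInvertible)
    (hL : IsFramedLeviCivita e L β (fun _ ↦ m) (fun _ ↦ Λ)) (η ζ : F →L[ℝ] ℝ) :
    fderiv ℝ Φ e (L e (framedNabla L (fun _ ↦ Λ) (gradientLift m L Φ ζ) e
        (gradientLift m L Φ η e)))
      = framedNabla (fun _ ↦ ContinuousLinearMap.id ℝ F) (christoffelL b)
        (fun q ↦ (b q).inverse ζ) (Φ e) ((b (Φ e)).inverse η) := by
  have hB := isFramedLeviCivita_christoffel h.contDiffAt_metric h.isInvertible h.symm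
  have c (η) := contDiffAt_gradientLift (m := m) hL.contDiffAt_frame h.contDiffAt η
  have c' (η) := (h.contDiffAt_inverse_apply η).of_le (m := 2) ENat.LEInfty.out
  have g (η) := isGradientAt_gradientLift hm hL h.contDiffAt η
  have g' (η) := isGradientAt_inverse_metric h.contDiffAt_metric h.isInvertible h.symm η
  refine (SeparatingDual.eq_iff_forall_dual_eq (R := ℝ)).2 fun κ ↦ ?_
  have k1 := (hL.koszul (c η) (c ζ) (c κ) (g η) (g ζ) (g κ)).self_of_nhds
  have k2 := (hB.koszul (c' η) (c' ζ) (c' κ) (g' η) (g' ζ) (g' κ)).self_of_nhds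
  have r := fun η ζ κ ↦ (h.fderiv_metric_gradientLift hm η ζ κ).self_of_nhds
  simp only [Function.comp_apply] at r
  rw [hL.symm.self_of_nhds, gradientLift_apply hm, r, r, r] at k1
  rw [h.symm.self_of_nhds, h.isInvertible.self_of_nhds.self_apply_inverse] at k2
  rw [k1, k2]
  simp

/-- `∇_X X` is horizontal for the lift `X` of a gradient field. -/
theorem framedNabla_self_horizontal (h : IsFramedSubmersion m L Φ e b) (hm : m.IsInvertible)
    (hL : IsFramedLeviCivita e L β (fun _ ↦ m) (fun _ ↦ Λ)) (η : F →L[ℝ] ℝ) (Z : V)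
    (hZ : fderiv ℝ Φ e (L e Z) = 0) :
    m (framedNabla L (fun _ ↦ Λ) (gradientLift m L Φ η) e (gradientLift m L Φ η e)) Z = 0 := by
  have c := contDiffAt_gradientLift (m := m) hL.contDiffAt_frame h.contDiffAt η
  have h1 := (hL.fderiv_metric_frame c c).self_of_nhds Z
  have h2 := (isGradientAt_gradientLift hm hL h.contDiffAt η).self_of_nhds Z
    (gradientLift m L Φ η e)
  rw [(h.metric_gradientLift hm η η).fderiv_eq, fderiv_comp e
    ((h.contDiffAt_metric_inverse η η).differentiableAt (by simp))
    (h.contDiffAt.differentiableAt (by simp)), ContinuousLinearMap.comp_apply, hZ, map_zero,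
    hL.symm.self_of_nhds (gradientLift m L Φ η e), h2] at h1
  linarith

/-- `∇_X Y` is perpendicular to the value of the vertical field `Z`. -/
theorem framedNabla_horizontal (h : IsFramedSubmersion m L Φ e b) (hm : m.IsInvertible)
    (hL : IsFramedLeviCivita e L β (fun _ ↦ m) (fun _ ↦ Λ)) (η : F →L[ℝ] ℝ) {X : V} {Z : E → V}
    (hZd : DifferentiableAt ℝ Z e) (hZ : ∀ᶠ p in 𝓝 e, fderiv ℝ Φ p (L p (Z p)) = 0)
    (hXZ : m (gradientLift m L Φ η e) (fderiv ℝ Z e (L e X) + Λ X (Z e)) = 0) :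
    m (framedNabla L (fun _ ↦ Λ) (gradientLift m L Φ η) e X) (Z e) = 0 := by
  have c := (contDiffAt_gradientLift (m := m) hL.contDiffAt_frame h.contDiffAt η).differentiableAt
    (by simp)
  have h0 : (fun p ↦ m (gradientLift m L Φ η p) (Z p)) =ᶠ[𝓝 e] fun _ ↦ 0 := by
    filter_upwards [hZ] with p hp
    rw [gradientLift_apply hm, hp, map_zero]
  have h1 := IsFramedLeviCivita.fderiv_metric (b := fun _ : E ↦ m) c hZd
    (differentiableAt_const _) (L e X)
  rw [h0.fderiv_eq] at h1
  have h2 := hL.compat.self_of_nhds X (gradientLift m L Φ η e) (Z e)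
  simp only [fderiv_fun_const, Pi.zero_apply, zero_apply] at h1 h2
  rw [map_add] at hXZ
  rw [framedNabla_apply, map_add, add_apply]
  linarith

/-- The curvature of the base of a Riemannian submersion, for a horizontal plane on which O'Neill's
tensor vanishes. -/
theorem metric_curvatureOperator (h : IsFramedSubmersion m L Φ e b) (hm : m.IsInvertible)
    (hL : IsFramedLeviCivita e L β (fun _ ↦ m) (fun _ ↦ Λ)) {X Y : V}
    (hX : ∀ Z, fderiv ℝ Φ e (L e Z) = 0 → m X Z = 0)
    (hY : ∀ Z, fderiv ℝ Φ e (L e Z) = 0 → m Y Z = 0) {S : Set V}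
    (hS : ∀ Z, fderiv ℝ Φ e (L e Z) = 0 → Z ∈ Submodule.span ℝ S)
    (hZ : ∀ Z₀ ∈ S, ∃ Z : E → V, Z e = Z₀ ∧ DifferentiableAt ℝ Z e ∧
      (∀ᶠ p in 𝓝 e, fderiv ℝ Φ p (L p (Z p)) = 0) ∧
      m Y (fderiv ℝ Z e (L e X) + Λ X Z₀) = 0) :
    b (Φ e) (curvatureOperator b (Φ e) (fderiv ℝ Φ e (L e X)) (fderiv ℝ Φ e (L e Y))
      (fderiv ℝ Φ e (L e Y))) (fderiv ℝ Φ e (L e X))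
      = m (framedCurvature L β (fun _ ↦ Λ) e X Y Y) X := by
  have hB := isFramedLeviCivita_christoffel h.contDiffAt_metric h.isInvertible h.symm
  have c (η) := contDiffAt_gradientLift (m := m) hL.contDiffAt_frame h.contDiffAt η
  have c' (η) := (h.contDiffAt_inverse_apply η).of_le (m := 2) ENat.LEInfty.out
  have g (η) := isGradientAt_gradientLift hm hL h.contDiffAt η
  have g' (η) := isGradientAt_inverse_metric h.contDiffAt_metric h.isInvertible h.symm η
  have hbi := h.isInvertible.self_of_nhds
  -- covectors whose gradient fields extend `X` and `Y`
  have lift : ∀ X : V, (∀ Z, fderiv ℝ Φ e (L e Z) = 0 → m X Z = 0) → ∃ η : F →L[ℝ] ℝ,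
      gradientLift m L Φ η e = X ∧ (b (Φ e)).inverse η = fderiv ℝ Φ e (L e X) := by
    intro X hX
    refine ⟨b (Φ e) (fderiv ℝ Φ e (L e X)), ?_, hbi.inverse_apply_self _⟩
    apply hm.injective
    ext A
    rw [gradientLift_apply hm, h.isometry.self_of_nhds X hX]
  obtain ⟨η, hη, hη'⟩ := lift X hX
  obtain ⟨ζ, hζ, hζ'⟩ := lift Y hY
  have iso (N N' : V) (hN : ∀ Z, fderiv ℝ Φ e (L e Z) = 0 → m N Z = 0) :
      b (Φ e) (fderiv ℝ Φ e (L e N)) (fderiv ℝ Φ e (L e N')) = m N N' :=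
    h.isometry.self_of_nhds N hN N'
  have hN : ∀ Z, fderiv ℝ Φ e (L e Z) = 0 →
      m (framedNabla L (fun _ ↦ Λ) (gradientLift m L Φ ζ) e (gradientLift m L Φ η e)) Z = 0 := by
    intro Z hZ0
    refine Submodule.span_induction (fun Z₀ h₀ ↦ ?_) (map_zero _)
      (fun x y _ _ hx hy ↦ by rw [map_add, hx, hy, add_zero])
      (fun a x _ hx ↦ by rw [map_smul, hx, smul_zero]) (hS Z hZ0)
    obtain ⟨Z, rfl, hd, hv, hm0⟩ := hZ Z₀ h₀
    rw [hη]
    exact h.framedNabla_horizontal hm hL ζ hd hv (by rw [hζ]; exact hm0)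
  have e1 := hL.metric_curvature (c η) (c ζ) (g η) (g ζ)
  have e2 := hB.metric_curvature (c' η) (c' ζ) (g' η) (g' ζ)
  rw [curvatureOperator_eq h.contDiffAt_metric h.isInvertible h.symm]
  have r1 : (fun p ↦ fderiv ℝ (fun q ↦ m (gradientLift m L Φ ζ q) (gradientLift m L Φ ζ q)) p
      (L p (gradientLift m L Φ η p)) / 2) =ᶠ[𝓝 e] (fun q ↦ fderiv ℝ (fun q ↦ b q ((b q).inverse ζ)
        ((b q).inverse ζ)) q ((b q).inverse η) / 2) ∘ Φ := by
    filter_upwards [h.fderiv_metric_gradientLift hm ζ ζ η] with p hp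
    rw [hp]
    rfl
  have r2 : (fun p ↦ fderiv ℝ (fun q ↦ m (gradientLift m L Φ ζ q) (gradientLift m L Φ η q)) p
      (L p (gradientLift m L Φ η p)) - fderiv ℝ (fun q ↦ m (gradientLift m L Φ η q)
        (gradientLift m L Φ η q)) p (L p (gradientLift m L Φ ζ p)) / 2) =ᶠ[𝓝 e]
      (fun q ↦ fderiv ℝ (fun q ↦ b q ((b q).inverse ζ) ((b q).inverse η)) q ((b q).inverse η)
        - fderiv ℝ (fun q ↦ b q ((b q).inverse η) ((b q).inverse η)) q ((b q).inverse ζ) / 2) ∘ Φ := by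
    filter_upwards [h.fderiv_metric_gradientLift hm ζ η η,
      h.fderiv_metric_gradientLift hm η η ζ] with p hp hp'
    rw [hp, hp']
    rfl
  have dΦ := h.contDiffAt.differentiableAt (by simp)
  rw [r1.fderiv_eq, r2.fderiv_eq,
    fderiv_comp e (((h.contDiffAt_fderiv_metric ζ ζ η).div_const 2).differentiableAt (by simp)) dΦ,
    fderiv_comp e (((h.contDiffAt_fderiv_metric ζ η η).sub
      ((h.contDiffAt_fderiv_metric η η ζ).div_const 2)).differentiableAt (by simp)) dΦ,
    ← iso _ _ (h.framedNabla_self_horizontal hm hL ζ), ← iso _ _ hN, ← iso _ _ hN] at e1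
  simp only [h.fderiv_framedNabla hm hL, hη', hζ'] at e1
  simp only [ContinuousLinearMap.comp_apply, hη, hζ] at e1
  simp only [ContinuousLinearMap.id_apply, hη', hζ'] at e2
  rw [e1, e2]

end IsFramedSubmersion

end Submersion

section InvariantLeviCivita

open Filter Topology VectorField

variable {V : Type*} [NormedAddCommGroup V] [NormedSpace ℝ V] [FiniteDimensional ℝ V]

/-- The Levi-Civita connection of the left-invariant metric given by the scalar product `m` on a
Lie algebra with bracket `β`. -/
noncomputable def invariantConnection (m : V →L[ℝ] V →L[ℝ] ℝ) (β : V →L[ℝ] V →L[ℝ] V) :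
    V →L[ℝ] V →L[ℝ] V :=
  (LinearMap.mk₂ ℝ (fun A B ↦ (1 / 2 : ℝ) • m.inverse
    (m (β A B) - m.flip B ∘L β A - m.flip A ∘L β B))
    (fun A A' B ↦ by
      rw [← smul_add, ← map_add]
      congr 2
      ext C
      simp
      ring)
    (fun c A B ↦ by
      rw [smul_comm c, ← map_smul m.inverse c]
      congr 2
      ext C
      simp
      ring)
    (fun A B B' ↦ by
      rw [← smul_add, ← map_add]
      congr 2
      ext C
      simp
      ring)
    (fun c A B ↦ by
      rw [smul_comm c, ← map_smul m.inverse c]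
      congr 2
      ext C
      simp
      ring)).toContinuousBilinearMap

variable {m Q : V →L[ℝ] V →L[ℝ] ℝ} {β : V →L[ℝ] V →L[ℝ] V} {P : V →ₗ[ℝ] V}

theorem metric_invariantConnection (hm : m.IsInvertible) (A B C : V) :
    m (invariantConnection m β A B) C = (m (β A B) C - m (β A C) B - m (β B C) A) / 2 := by
  have : invariantConnection m β A B = (1 / 2 : ℝ) • m.inverse
    (m (β A B) - m.flip B ∘L β A - m.flip A ∘L β B) := rfl
  rw [this, map_smul, hm.self_apply_inverse]
  simp
  ring

theorem invariantConnection_torsion (hm : m.IsInvertible) (hβ : ∀ A B, β A B = -β B A) (A B : V) :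
    invariantConnection m β A B - invariantConnection m β B A = β A B := by
  apply hm.injective
  ext C
  rw [map_sub, sub_apply, metric_invariantConnection hm, metric_invariantConnection hm, hβ B A,
    map_neg, neg_apply]
  ring

theorem invariantConnection_compat (hm : m.IsInvertible) (hβ : ∀ A B, β A B = -β B A)
    (hs : ∀ A B, m A B = m B A) (A B C : V) :
    m (invariantConnection m β A B) C + m B (invariantConnection m β A C) = 0 := by
  rw [hs B, metric_invariantConnection hm, metric_invariantConnection hm, hβ C B, map_neg, neg_apply]
  ring

theorem isFramedLeviCivita_invariantConnection {E : Type*} [NormedAddCommGroup E] [NormedSpace ℝ E]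
    {e : E} {L : E → V →L[ℝ] E} (hL : ContDiffAt ℝ 2 L e)
    (hLβ : ∀ᶠ p in 𝓝 e, ∀ A B, lieBracket ℝ (fun q ↦ L q A) (fun q ↦ L q B) p = L p (β A B))
    (hm : m.IsInvertible) (hβ : ∀ A B, β A B = -β B A) (hs : ∀ A B, m A B = m B A) :
    IsFramedLeviCivita e L (fun A B ↦ β A B) (fun _ ↦ m) (fun _ ↦ invariantConnection m β) where
  contDiffAt_frame := hL
  contDiffAt_metric := contDiffAt_const
  contDiffAt_connection := contDiffAt_const
  lieBracket_frame := hLβ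
  symm := Eventually.of_forall fun _ ↦ hs
  compat := Eventually.of_forall fun _ A B C ↦ by
    rw [invariantConnection_compat hm hβ hs]
    simp
  torsion := Eventually.of_forall fun _ ↦ invariantConnection_torsion hm hβ

/-- A left-invariant metric `m` and a bi-invariant metric `Q` on a Lie algebra with bracket `β`,
related by the metric tensor `P`. -/
structure IsMetricTensor (m Q : V →L[ℝ] V →L[ℝ] ℝ) (β : V →L[ℝ] V →L[ℝ] V) (P : V →ₗ[ℝ] V) :
    Prop where
  skew : ∀ A B, β A B = -β B A
  symm : ∀ A B, m A B = m B A
  pos : ∀ A, A ≠ 0 → 0 < m A A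
  symm' : ∀ A B, Q A B = Q B A
  pos' : ∀ A, A ≠ 0 → 0 < Q A A
  invariant : ∀ A B C, Q (β A B) C = -Q B (β A C)
  metric_eq : ∀ A B, m A B = Q A (P B)

namespace IsMetricTensor

theorem isInvertible (h : IsMetricTensor m Q β P) : m.IsInvertible := isInvertible_of_pos h.pos

theorem bracket_self (h : IsMetricTensor m Q β P) (A : V) : β A A = 0 := by
  have := h.skew A A
  rwa [eq_neg_iff_add_eq_zero, ← two_smul ℝ, smul_eq_zero, or_iff_right two_ne_zero] at this

theorem two_mul_metric_connection (h : IsMetricTensor m Q β P) (A B C : V) :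
    2 * m (invariantConnection m β A B) C
      = Q (β A B) (P C) + Q C (β A (P B)) + Q C (β B (P A)) := by
  rw [metric_invariantConnection h.isInvertible, h.metric_eq, h.metric_eq, h.metric_eq,
    h.invariant A C, h.invariant B C]
  ring

theorem metric_curvature (h : IsMetricTensor m Q β P) {E : Type*} [NormedAddCommGroup E]
    [NormedSpace ℝ E] (e : E) (L : E → V →L[ℝ] E) (X Y : V) :
    m (framedCurvature L (fun A B ↦ β A B) (fun _ ↦ invariantConnection m β) e X Y Y) X
      = -m (invariantConnection m β Y Y) (invariantConnection m β X X)
        + m (invariantConnection m β X Y) (invariantConnection m β Y X)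
        + m Y (invariantConnection m β (β X Y) X) := by
  have hc := invariantConnection_compat h.isInvertible h.skew h.symm
  simp only [framedCurvature, fderiv_fun_const, Pi.zero_apply, zero_apply, sub_zero, zero_add,
    map_sub, sub_apply]
  linarith [hc X (invariantConnection m β Y Y) X, hc Y (invariantConnection m β X Y) X,
    hc (β X Y) Y X]

/-- The condition which makes O'Neill's tensor vanish. -/
theorem metric_vertical (h : IsMetricTensor m Q β P) (X Y Z W : V) :
    m Y (-β X W + invariantConnection m β X Z)
      = Q W (β X (P Y)) - m (invariantConnection m β X Y) Z := by
  have hc := invariantConnection_compat h.isInvertible h.skew h.symm X Y Z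
  rw [map_add, map_neg, h.symm Y (β X W), h.metric_eq, h.invariant]
  linarith

theorem eq_of_metric (h : IsMetricTensor m Q β P) {A B : V} (hAB : ∀ C, m A C = m B C) : A = B :=
  h.isInvertible.injective (ContinuousLinearMap.ext hAB)

theorem eq_of_metric' (h : IsMetricTensor m Q β P) {A B : V} (hAB : ∀ C, Q C A = Q C B) : A = B :=
  (isInvertible_of_pos h.pos').injective (ContinuousLinearMap.ext fun C ↦ by
    rw [h.symm' A, h.symm' B, hAB])

theorem injective (h : IsMetricTensor m Q β P) : Function.Injective P := fun A B hAB ↦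
  h.eq_of_metric fun C ↦ by rw [h.symm A, h.symm B, h.metric_eq, h.metric_eq, hAB]

theorem flat_of_commuting (h : IsMetricTensor m Q β P) {W₁ W₂ : Submodule ℝ V}
    (h₁ : ∀ A ∈ W₁, P A ∈ W₁) (h₂ : ∀ A ∈ W₂, P A ∈ W₂) (h₁₂ : ∀ A ∈ W₁, ∀ B ∈ W₂, β A B = 0)
    {X Y : V} (hX : X ∈ W₁) (hY : Y ∈ W₂) (hYP : β Y (P Y) ∈ W₂) {E : Type*} [NormedAddCommGroup E]
    [NormedSpace ℝ E] (e : E) (L : E → V →L[ℝ] E) :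
    m (framedCurvature L (fun A B ↦ β A B) (fun _ ↦ invariantConnection m β) e X Y Y) X = 0 ∧
      ∀ Z W, m Y (-β X W + invariantConnection m β X Z) = 0 := by
  have hXY := h₁₂ X hX Y hY
  have hXPY := h₁₂ X hX _ (h₂ Y hY)
  have hYPX : β Y (P X) = 0 := by rw [h.skew, h₁₂ _ (h₁ X hX) Y hY, neg_zero]
  have hYX : β Y X = 0 := by rw [h.skew, hXY, neg_zero]
  have zXY : invariantConnection m β X Y = 0 := h.eq_of_metric fun C ↦ by
    have := h.two_mul_metric_connection X Y C
    rw [hXY, hXPY, hYPX] at this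
    simpa using this
  -- `P` is onto on the finite-dimensional space `W₂`
  obtain ⟨w, hw, hwP⟩ : ∃ w ∈ W₂, P w = β Y (P Y) := by
    have hinj : Function.Injective (P.restrict h₂) := fun A B hAB ↦
      Subtype.ext (h.injective (congrArg Subtype.val hAB))
    obtain ⟨w, hw⟩ := (LinearMap.injective_iff_surjective.1 hinj) ⟨_, hYP⟩
    exact ⟨w, w.2, congrArg Subtype.val hw⟩
  have hself (A : V) (C : V) : m (invariantConnection m β A A) C = Q C (β A (P A)) := by
    have := h.two_mul_metric_connection A A C
    have h0 : β A A = 0 := h.bracket_self A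
    rw [h0, map_zero, zero_apply] at this
    linarith
  have zYY : invariantConnection m β Y Y = w := h.eq_of_metric fun C ↦ by
    rw [hself, ← hwP, h.symm w, h.metric_eq]
  refine ⟨?_, fun Z W ↦ ?_⟩
  · rw [h.metric_curvature, zXY, hXY, zYY, h.symm w, hself, h.symm', h.symm' (β X _),
      ← neg_neg (Q w _), ← h.invariant, h₁₂ X hX w hw]
    simp
  · rw [h.metric_vertical, hXPY, zXY]
    simp

theorem flat_of_eigenspace (h : IsMetricTensor m Q β P) {X Y : V} {c : ℝ}
    (hX : ∀ A B, m (β X A) B = -m A (β X B)) (hY : P Y = c • Y)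
    (hXY : P (β X Y) = c • β X Y) (hPXY : β (P X) Y = 0) {E : Type*} [NormedAddCommGroup E]
    [NormedSpace ℝ E] (e : E) (L : E → V →L[ℝ] E) :
    m (framedCurvature L (fun A B ↦ β A B) (fun _ ↦ invariantConnection m β) e X Y Y) X = 0 ∧
      ∀ Z W, m (β X Y) W = 0 → m Y (-β X (Z + W) + invariantConnection m β X Z) = 0 := by
  have hXP (B : V) : β X (P B) = P (β X B) := h.eq_of_metric' fun A ↦ by
    have := hX A B
    rw [h.metric_eq, h.metric_eq, h.invariant] at this
    linarith
  have hYPX : β Y (P X) = 0 := by rw [h.skew, hPXY, neg_zero]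
  have hXX : β X X = 0 := h.bracket_self X
  have hmc (C : V) : m (β X Y) C = c * Q C (β X Y) := by
    rw [h.symm, h.metric_eq, hXY, map_smul, smul_eq_mul]
  have zXX : invariantConnection m β X X = 0 := h.eq_of_metric fun C ↦ by
    have := h.two_mul_metric_connection X X C
    rw [hXP, hXX] at this
    simpa using this
  have zXY : invariantConnection m β X Y = β X Y := h.eq_of_metric fun C ↦ by
    have := h.two_mul_metric_connection X Y C
    rw [hXP, hXY, hYPX, ← h.metric_eq, hmc, map_smul, smul_eq_mul, map_zero] at this
    rw [hmc]
    linarith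
  have zYX : invariantConnection m β Y X = 0 := h.eq_of_metric fun C ↦ by
    have := h.two_mul_metric_connection Y X C
    rw [hXP, hXY, hYPX, ← h.metric_eq, h.skew Y X, map_neg, neg_apply, hmc, map_smul, smul_eq_mul,
      map_zero] at this
    rw [map_zero, zero_apply]
    linarith
  refine ⟨?_, fun Z W hW ↦ ?_⟩
  · have h3 := h.two_mul_metric_connection (β X Y) X Y
    have h4 := h.invariant (P X) (β X Y) Y
    rw [hPXY, map_zero, h.symm' (β (P X) _), h.skew (P X), map_neg] at h4
    rw [hXY, hY, h.skew (β X Y) X, map_smul, map_smul, map_smul, map_neg, neg_apply,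
      h.symm' (β X (β X Y)) Y] at h3
    rw [h.metric_curvature, zXX, zYX, map_zero, map_zero, h.symm Y]
    simp only [smul_eq_mul] at h3
    linarith
  · rw [h.metric_vertical, zXY, hmc, hY, map_smul, map_smul, smul_eq_mul, map_add, add_apply]
    rw [hmc] at hW
    linarith

end IsMetricTensor

end InvariantLeviCivita

section ChartMetric

open Filter Topology

variable {E : Type*} [NormedAddCommGroup E] [NormedSpace ℝ E]
  {M : Type*} [TopologicalSpace M] [ChartedSpace E M] [IsManifold 𝓘(ℝ, E) ∞ M]

theorem contMDiffAt_extChartAt_symm (x : M) {e : E} (he : e ∈ (extChartAt 𝓘(ℝ, E) x).target) :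
    ContMDiffAt 𝓘(ℝ, E) 𝓘(ℝ, E) ∞ (extChartAt 𝓘(ℝ, E) x).symm e :=
  (contMDiffOn_extChartAt_symm x).contMDiffAt ((isOpen_extChartAt_target x).mem_nhds he)

theorem contMDiffAt_extChartAt_of_mem (x : M) {y : M} (hy : y ∈ (extChartAt 𝓘(ℝ, E) x).source) :
    ContMDiffAt 𝓘(ℝ, E) 𝓘(ℝ, E) ∞ (extChartAt 𝓘(ℝ, E) x) y :=
  contMDiffAt_extChartAt' (by rwa [extChartAt_source] at hy)

theorem mfderiv_extChartAt_mfderiv_symm (x : M) {e : E}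
    (he : e ∈ (extChartAt 𝓘(ℝ, E) x).target) (v : E) :
    (mfderiv 𝓘(ℝ, E) 𝓘(ℝ, E) (extChartAt 𝓘(ℝ, E) x) ((extChartAt 𝓘(ℝ, E) x).symm e)
      (mfderiv 𝓘(ℝ, E) 𝓘(ℝ, E) (extChartAt 𝓘(ℝ, E) x).symm e v) : E) = v := by
  have := mfderiv_extChartAt_comp_mfderivWithin_extChartAt_symm (I := 𝓘(ℝ, E)) he
  rw [ModelWithCorners.range_eq_univ, mfderivWithin_univ] at this
  exact congrArg (fun T : E →L[ℝ] E ↦ T v) this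

theorem mfderiv_symm_mfderiv_extChartAt (x : M) {y : M}
    (hy : y ∈ (extChartAt 𝓘(ℝ, E) x).source) (v : TangentSpace 𝓘(ℝ, E) y) :
    (mfderiv 𝓘(ℝ, E) 𝓘(ℝ, E) (extChartAt 𝓘(ℝ, E) x).symm (extChartAt 𝓘(ℝ, E) x y)
      (mfderiv 𝓘(ℝ, E) 𝓘(ℝ, E) (extChartAt 𝓘(ℝ, E) x) y v) : E) = v := by
  have := mfderivWithin_extChartAt_symm_comp_mfderiv_extChartAt' (I := 𝓘(ℝ, E)) hy
  rw [ModelWithCorners.range_eq_univ, mfderivWithin_univ] at this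
  exact congrArg (fun T : E →L[ℝ] E ↦ T v) this

theorem mfderiv_extChartAt_symm_self (x : M) :
    (mfderiv 𝓘(ℝ, E) 𝓘(ℝ, E) (extChartAt 𝓘(ℝ, E) x).symm (extChartAt 𝓘(ℝ, E) x x) : E →L[ℝ] E)
      = ContinuousLinearMap.id ℝ E := by
  ext v
  have h := mfderiv_symm_mfderiv_extChartAt x (mem_extChartAt_source (I := 𝓘(ℝ, E)) x) v
  have h2 : (mfderiv 𝓘(ℝ, E) 𝓘(ℝ, E) (extChartAt 𝓘(ℝ, E) x) x v : E) = v :=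
    congrArg (fun T : E →L[ℝ] E ↦ T v) mfderiv_extChartAt_self
  rw [h2] at h
  exact h

theorem chartMetric_apply (g : SmoothMetric E M) (x : M) (e v w : E) :
    chartMetric g x e v w = g.inner ((extChartAt 𝓘(ℝ, E) x).symm e)
      (mfderiv 𝓘(ℝ, E) 𝓘(ℝ, E) (extChartAt 𝓘(ℝ, E) x).symm e v)
      (mfderiv 𝓘(ℝ, E) 𝓘(ℝ, E) (extChartAt 𝓘(ℝ, E) x).symm e w) := rfl

theorem chartMetric_symm (g : SmoothMetric E M) (x : M) (e v w : E) :
    chartMetric g x e v w = chartMetric g x e w v := by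
  rw [chartMetric_apply, chartMetric_apply, g.symm]

theorem chartMetric_pos (g : SmoothMetric E M) (x : M) {e : E}
    (he : e ∈ (extChartAt 𝓘(ℝ, E) x).target) (v : E) (hv : v ≠ 0) : 0 < chartMetric g x e v v := by
  rw [chartMetric_apply]
  refine g.pos _ _ fun h ↦ hv ?_
  rw [← mfderiv_extChartAt_mfderiv_symm x he v, h]
  exact map_zero _

variable [FiniteDimensional ℝ E]

theorem contDiffAt_chartMetric (g : SmoothMetric E M) (x : M) :
    ContDiffAt ℝ ∞ (chartMetric g x) (extChartAt 𝓘(ℝ, E) x x) := by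
  set c := extChartAt 𝓘(ℝ, E) x with hc
  have hopen : IsOpen c.target := isOpen_extChartAt_target x
  have hx : c x ∈ c.target := mem_extChartAt_target x
  have vec (v : E) : ContMDiffOn 𝓘(ℝ, E) (𝓘(ℝ, E).prod 𝓘(ℝ, E)) ∞
      (fun e ↦ TotalSpace.mk' E (E := fun y : M ↦ TangentSpace 𝓘(ℝ, E) y) (c.symm e)
        (mfderiv 𝓘(ℝ, E) 𝓘(ℝ, E) c.symm e v)) c.target := by
    have h1 := (contMDiffOn_extChartAt_symm (I := 𝓘(ℝ, E)) (n := ∞) x).contMDiffOn_tangentMapWithin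
      (m := ∞) (by simp) hopen.uniqueMDiffOn
    have h2 : ContMDiff 𝓘(ℝ, E) (𝓘(ℝ, E).prod 𝓘(ℝ, E)) ∞
        (fun e : E ↦ TotalSpace.mk' E (E := fun y : E ↦ TangentSpace 𝓘(ℝ, E) y) e v) := by
      exact fun e ↦ contMDiffAt_vectorSpace_iff_contDiffAt.2 contDiffAt_const
    refine (h1.comp h2.contMDiffOn fun e he ↦ he).congr fun e he ↦ ?_
    simp only [Function.comp_apply, tangentMapWithin]
    rw [mfderivWithin_of_isOpen hopen he]
  have key (v w : E) : ContDiffOn ℝ ∞ (fun e ↦ chartMetric g x e v w) c.target := by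
    have h1 : ContMDiffOn 𝓘(ℝ, E) (𝓘(ℝ, E).prod 𝓘(ℝ)) ∞
        (fun e ↦ TotalSpace.mk' ℝ (E := Bundle.Trivial M ℝ) (c.symm e)
          (g.inner (c.symm e) (mfderiv 𝓘(ℝ, E) 𝓘(ℝ, E) c.symm e v)
            (mfderiv 𝓘(ℝ, E) 𝓘(ℝ, E) c.symm e w))) c.target := by
      refine ContMDiffOn.clm_bundle_apply₂ (F₁ := E) (F₂ := E) ?_ (vec v) (vec w)
      exact g.contMDiff.comp_contMDiffOn (contMDiffOn_extChartAt_symm x)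
    intro e he
    have h2 := h1 e he
    simp only [contMDiffWithinAt_totalSpace] at h2
    exact h2.2.contDiffWithinAt
  have h3 : ContDiffOn ℝ ∞ (chartMetric g x) c.target := by
    refine contDiffOn_clm_apply.2 fun v ↦ contDiffOn_clm_apply.2 fun w ↦ key v w
  exact h3.contDiffAt (hopen.mem_nhds hx)

end ChartMetric

section ModelDerivative

open Filter Topology

variable {E : Type*} [NormedAddCommGroup E] [NormedSpace ℝ E]
  {M : Type*} [TopologicalSpace M] [ChartedSpace E M]
  {F : Type*} [NormedAddCommGroup F] [NormedSpace ℝ F]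
  {N : Type*} [TopologicalSpace N] [ChartedSpace F N]
  {H : Type*} [NormedAddCommGroup H] [NormedSpace ℝ H]
  {R : Type*} [TopologicalSpace R] [ChartedSpace H R]

/-- The differential of `f` at `x`, as a linear map between the model spaces. -/
noncomputable def modelDeriv (E F : Type*) [NormedAddCommGroup E] [NormedSpace ℝ E]
    [NormedAddCommGroup F] [NormedSpace ℝ F] {M : Type*} [TopologicalSpace M] [ChartedSpace E M]
    {N : Type*} [TopologicalSpace N] [ChartedSpace F N] (f : M → N) (x : M) : E →L[ℝ] F :=
  mfderiv 𝓘(ℝ, E) 𝓘(ℝ, F) f x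

theorem modelDeriv_comp {g : N → R} {f : M → N} (x : M)
    (hg : MDifferentiableAt 𝓘(ℝ, F) 𝓘(ℝ, H) g (f x)) (hf : MDifferentiableAt 𝓘(ℝ, E) 𝓘(ℝ, F) f x) :
    modelDeriv E H (g ∘ f) x = modelDeriv F H g (f x) ∘L modelDeriv E F f x :=
  mfderiv_comp x hg hf

theorem modelDeriv_congr {f g : M → N} {x : M} (h : f =ᶠ[𝓝 x] g) :
    modelDeriv E F f x = modelDeriv E F g x := by
  ext v
  exact congrArg (fun T : E →L[ℝ] F ↦ T v) h.mfderiv_eq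

theorem modelDeriv_eq_fderiv {f : E → F} {x : E} : modelDeriv E F f x = fderiv ℝ f x :=
  mfderiv_eq_fderiv

theorem modelDeriv_id (x : M) : modelDeriv E E (id : M → M) x = ContinuousLinearMap.id ℝ E :=
  mfderiv_id

theorem modelDeriv_const (x : M) (y : N) : modelDeriv E F (fun _ : M ↦ y) x = 0 :=
  mfderiv_const

variable [IsManifold 𝓘(ℝ, E) ∞ M]

theorem modelDeriv_extChartAt_modelDeriv_symm (x : M) {e : E}
    (he : e ∈ (extChartAt 𝓘(ℝ, E) x).target) (v : E) :
    modelDeriv E E (extChartAt 𝓘(ℝ, E) x) ((extChartAt 𝓘(ℝ, E) x).symm e)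
      (modelDeriv E E (extChartAt 𝓘(ℝ, E) x).symm e v) = v :=
  mfderiv_extChartAt_mfderiv_symm x he v

theorem modelDeriv_symm_modelDeriv_extChartAt (x : M) {y : M}
    (hy : y ∈ (extChartAt 𝓘(ℝ, E) x).source) (v : E) :
    modelDeriv E E (extChartAt 𝓘(ℝ, E) x).symm (extChartAt 𝓘(ℝ, E) x y)
      (modelDeriv E E (extChartAt 𝓘(ℝ, E) x) y v) = v :=
  mfderiv_symm_mfderiv_extChartAt x hy v

theorem modelDeriv_extChartAt_self (x : M) :
    modelDeriv E E (extChartAt 𝓘(ℝ, E) x) x = ContinuousLinearMap.id ℝ E :=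
  mfderiv_extChartAt_self

theorem modelDeriv_extChartAt_symm_self (x : M) :
    modelDeriv E E (extChartAt 𝓘(ℝ, E) x).symm (extChartAt 𝓘(ℝ, E) x x)
      = ContinuousLinearMap.id ℝ E :=
  mfderiv_extChartAt_symm_self x

end ModelDerivative

section GroupChart

open Filter Topology VectorField

variable {E : Type*} [NormedAddCommGroup E] [NormedSpace ℝ E]
  {G : Type*} [TopologicalSpace G] [ChartedSpace E G] [Group G]

/-- The multiplication of the Lie group `G`, in the chart at `1`. -/
noncomputable def chartMul (E G : Type*) [NormedAddCommGroup E] [NormedSpace ℝ E]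
    [TopologicalSpace G] [ChartedSpace E G] [Group G] (p : E × E) : E :=
  extChartAt 𝓘(ℝ, E) (1 : G)
    ((extChartAt 𝓘(ℝ, E) (1 : G)).symm p.1 * (extChartAt 𝓘(ℝ, E) (1 : G)).symm p.2)

/-- The coordinates of the identity in the chart at `1`. -/
noncomputable def chartOne (E G : Type*) [NormedAddCommGroup E] [NormedSpace ℝ E]
    [TopologicalSpace G] [ChartedSpace E G] [Group G] : E :=
  extChartAt 𝓘(ℝ, E) (1 : G) 1

/-- The frame of left-invariant vector fields, in the chart at `1`. -/
noncomputable def leftFrame (E G : Type*) [NormedAddCommGroup E] [NormedSpace ℝ E]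
    [TopologicalSpace G] [ChartedSpace E G] [Group G] (e : E) : E →L[ℝ] E :=
  fderiv ℝ (chartMul E G) (e, chartOne E G) ∘L ContinuousLinearMap.inr ℝ E E

/-- The frame of right-invariant vector fields, in the chart at `1`. -/
noncomputable def rightFrame (E G : Type*) [NormedAddCommGroup E] [NormedSpace ℝ E]
    [TopologicalSpace G] [ChartedSpace E G] [Group G] (e : E) : E →L[ℝ] E :=
  fderiv ℝ (chartMul E G) (chartOne E G, e) ∘L ContinuousLinearMap.inl ℝ E E

local notation "𝔠" => extChartAt 𝓘(ℝ, E) (1 : G)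
local notation "e₀" => chartOne E G

theorem extChartAt_symm_chartOne : (𝔠).symm e₀ = 1 := extChartAt_to_inv (I := 𝓘(ℝ, E)) (1 : G)

theorem chartOne_mem_target : e₀ ∈ (𝔠).target := mem_extChartAt_target (1 : G)

theorem target_mem_nhds : (𝔠).target ∈ 𝓝 e₀ :=
  extChartAt_target_mem_nhds (1 : G)

variable [LieGroup 𝓘(ℝ, E) ∞ G]

theorem mdifferentiableAt_leftMul (a x : G) : MDifferentiableAt 𝓘(ℝ, E) 𝓘(ℝ, E) (a * ·) x :=
  (contMDiff_mul_left (I := 𝓘(ℝ, E)) (n := ∞)).contMDiffAt.mdifferentiableAt (by simp)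

theorem mdifferentiableAt_rightMul (a x : G) : MDifferentiableAt 𝓘(ℝ, E) 𝓘(ℝ, E) (· * a) x :=
  (contMDiff_mul_right (I := 𝓘(ℝ, E)) (n := ∞)).contMDiffAt.mdifferentiableAt (by simp)

theorem contDiffAt_chartMul : ContDiffAt ℝ ∞ (chartMul E G) (e₀, e₀) := by
  rw [← contMDiffAt_iff_contDiffAt]
  have h := contMDiffAt_extChartAt_symm (1 : G) (chartOne_mem_target (E := E) (G := G))
  have h1 : ContMDiffAt 𝓘(ℝ, E × E) 𝓘(ℝ, E) ∞ (fun p : E × E ↦ (𝔠).symm p.1) (e₀, e₀) :=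
    ContMDiffAt.comp (g := (𝔠).symm) (f := Prod.fst) (e₀, e₀) h contDiff_fst.contMDiff.contMDiffAt
  have h2 : ContMDiffAt 𝓘(ℝ, E × E) 𝓘(ℝ, E) ∞ (fun p : E × E ↦ (𝔠).symm p.2) (e₀, e₀) :=
    ContMDiffAt.comp (g := (𝔠).symm) (f := Prod.snd) (e₀, e₀) h contDiff_snd.contMDiff.contMDiffAt
  refine ContMDiffAt.comp (g := 𝔠) (f := fun p : E × E ↦ (𝔠).symm p.1 * (𝔠).symm p.2) (e₀, e₀) ?_
    (h1.mul h2)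
  refine contMDiffAt_extChartAt_of_mem (1 : G) ?_
  rw [extChartAt_symm_chartOne, mul_one]
  exact mem_extChartAt_source (1 : G)

theorem eventually_differentiableAt_chartMul_left :
    ∀ᶠ e in 𝓝 e₀, DifferentiableAt ℝ (chartMul E G) (e, e₀) := by
  have h := (contDiffAt_chartMul (E := E) (G := G)).of_le (m := 2) ENat.LEInfty.out
  have h2 : ContinuousAt (fun e : E ↦ (e, e₀)) e₀ := by fun_prop
  exact h2.eventually (IsFramedLeviCivita.eventually_differentiableAt h)

theorem eventually_differentiableAt_chartMul_right :
    ∀ᶠ e in 𝓝 e₀, DifferentiableAt ℝ (chartMul E G) (e₀, e) := by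
  have h := (contDiffAt_chartMul (E := E) (G := G)).of_le (m := 2) ENat.LEInfty.out
  have h2 : ContinuousAt (fun e : E ↦ (e₀, e)) e₀ := by fun_prop
  exact h2.eventually (IsFramedLeviCivita.eventually_differentiableAt h)

theorem contDiffAt_leftFrame : ContDiffAt ℝ ∞ (leftFrame E G) e₀ := by
  have h : ContDiffAt ℝ ∞ (fderiv ℝ (chartMul E G)) (e₀, e₀) :=
    contDiffAt_chartMul.fderiv_right (by simp)
  have h2 : ContDiffAt ℝ ∞ (fun e : E ↦ (e, e₀)) e₀ := by fun_prop
  exact (ContDiffAt.comp (f := fun e : E ↦ (e, e₀)) e₀ h h2).clm_comp contDiffAt_const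

theorem contDiffAt_rightFrame : ContDiffAt ℝ ∞ (rightFrame E G) e₀ := by
  have h : ContDiffAt ℝ ∞ (fderiv ℝ (chartMul E G)) (e₀, e₀) :=
    contDiffAt_chartMul.fderiv_right (by simp)
  have h2 : ContDiffAt ℝ ∞ (fun e : E ↦ (e₀, e)) e₀ := by fun_prop
  exact (ContDiffAt.comp (f := fun e : E ↦ (e₀, e)) e₀ h h2).clm_comp contDiffAt_const

/-- `leftFrame` consists of the left-invariant vector fields. -/
theorem modelDeriv_symm_leftFrame : ∀ᶠ e in 𝓝 e₀, ∀ A : E,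
    modelDeriv E E (𝔠).symm e (leftFrame E G e A) = modelDeriv E E ((𝔠).symm e * ·) 1 A := by
  filter_upwards [target_mem_nhds (E := E) (G := G), eventually_differentiableAt_chartMul_left]
    with e he hd A
  have hs := (contMDiffAt_extChartAt_symm (1 : G) he).mdifferentiableAt (by simp)
  have hs0 := (contMDiffAt_extChartAt_symm (1 : G)
    (chartOne_mem_target (E := E) (G := G))).mdifferentiableAt (by simp)
  have hcm : chartMul E G (e, e₀) = e := by
    rw [chartMul, extChartAt_symm_chartOne, mul_one, (𝔠).right_inv he]
  have hev : (𝔠).symm ∘ (fun y ↦ chartMul E G (e, y)) =ᶠ[𝓝 e₀] (fun z ↦ (𝔠).symm e * z) ∘ (𝔠).symm := by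
    have hc : ContinuousAt (fun y ↦ (𝔠).symm e * (𝔠).symm y) e₀ :=
      ((mdifferentiableAt_leftMul (E := E) ((𝔠).symm e) _).comp e₀ hs0).continuousAt
    have hm : (𝔠).source ∈ 𝓝 ((𝔠).symm e * (𝔠).symm e₀) := by
      rw [extChartAt_symm_chartOne, mul_one]
      exact (isOpen_extChartAt_source (1 : G)).mem_nhds ((𝔠).map_target he)
    filter_upwards [hc hm] with y hy
    exact (𝔠).left_inv hy
  have hy : HasFDerivAt (fun y ↦ chartMul E G (e, y)) (leftFrame E G e) e₀ :=
    hd.hasFDerivAt.comp e₀ (hasFDerivAt_prodMk_right e e₀)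
  have h1 := modelDeriv_congr (E := E) (F := E) hev
  rw [modelDeriv_comp e₀ (by rwa [hcm]) hy.differentiableAt.mdifferentiableAt,
    modelDeriv_comp e₀ (mdifferentiableAt_leftMul _ _) hs0, modelDeriv_eq_fderiv, hy.fderiv,
    hcm, extChartAt_symm_chartOne, chartOne, modelDeriv_extChartAt_symm_self] at h1
  exact congrArg (fun T : E →L[ℝ] E ↦ T A) h1

/-- `rightFrame` consists of the right-invariant vector fields. -/
theorem modelDeriv_symm_rightFrame : ∀ᶠ e in 𝓝 e₀, ∀ A : E,
    modelDeriv E E (𝔠).symm e (rightFrame E G e A) = modelDeriv E E (· * (𝔠).symm e) 1 A := by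
  filter_upwards [target_mem_nhds (E := E) (G := G), eventually_differentiableAt_chartMul_right]
    with e he hd A
  have hs := (contMDiffAt_extChartAt_symm (1 : G) he).mdifferentiableAt (by simp)
  have hs0 := (contMDiffAt_extChartAt_symm (1 : G)
    (chartOne_mem_target (E := E) (G := G))).mdifferentiableAt (by simp)
  have hcm : chartMul E G (e₀, e) = e := by
    rw [chartMul, extChartAt_symm_chartOne, one_mul, (𝔠).right_inv he]
  have hev : (𝔠).symm ∘ (fun y ↦ chartMul E G (y, e)) =ᶠ[𝓝 e₀] (fun z ↦ z * (𝔠).symm e) ∘ (𝔠).symm := by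
    have hc : ContinuousAt (fun y ↦ (𝔠).symm y * (𝔠).symm e) e₀ :=
      ((mdifferentiableAt_rightMul (E := E) ((𝔠).symm e) _).comp e₀ hs0).continuousAt
    have hm : (𝔠).source ∈ 𝓝 ((𝔠).symm e₀ * (𝔠).symm e) := by
      rw [extChartAt_symm_chartOne, one_mul]
      exact (isOpen_extChartAt_source (1 : G)).mem_nhds ((𝔠).map_target he)
    filter_upwards [hc hm] with y hy
    exact (𝔠).left_inv hy
  have hy : HasFDerivAt (fun y ↦ chartMul E G (y, e)) (rightFrame E G e) e₀ :=
    HasFDerivAt.comp (g := chartMul E G) (f := fun y ↦ (y, e)) e₀ hd.hasFDerivAt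
      (hasFDerivAt_prodMk_left e₀ e)
  have h1 := modelDeriv_congr (E := E) (F := E) hev
  rw [modelDeriv_comp e₀ (by rwa [hcm]) hy.differentiableAt.mdifferentiableAt,
    modelDeriv_comp e₀ (mdifferentiableAt_rightMul _ _) hs0, modelDeriv_eq_fderiv, hy.fderiv,
    hcm, extChartAt_symm_chartOne, chartOne, modelDeriv_extChartAt_symm_self] at h1
  exact congrArg (fun T : E →L[ℝ] E ↦ T A) h1

theorem leftFrame_chartOne : leftFrame E G e₀ = ContinuousLinearMap.id ℝ E := by
  ext A
  have h := modelDeriv_symm_leftFrame (E := E) (G := G).self_of_nhds A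
  have h1 : ((1 : G) * ·) = id := funext one_mul
  rw [extChartAt_symm_chartOne, chartOne, modelDeriv_extChartAt_symm_self, h1, modelDeriv_id] at h
  exact h

theorem rightFrame_chartOne : rightFrame E G e₀ = ContinuousLinearMap.id ℝ E := by
  ext A
  have h := modelDeriv_symm_rightFrame (E := E) (G := G).self_of_nhds A
  have h1 : (fun x : G ↦ x * 1) = id := funext mul_one
  rw [extChartAt_symm_chartOne, chartOne, modelDeriv_extChartAt_symm_self, h1, modelDeriv_id] at h
  exact h

/-- The Lie bracket of the Lie algebra of `G`, on the model space. -/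
noncomputable def modelBracket (E G : Type*) [NormedAddCommGroup E] [NormedSpace ℝ E]
    [TopologicalSpace G] [ChartedSpace E G] [Group G] (A B : E) : E :=
  Bracket.bracket (L := GroupLieAlgebra 𝓘(ℝ, E) G) (M := GroupLieAlgebra 𝓘(ℝ, E) G) A B

theorem lieGroup_minSmoothness : LieGroup 𝓘(ℝ, E) (minSmoothness ℝ 3) G := by
  rw [minSmoothness_of_isRCLikeNormedField]
  infer_instance

theorem lieBracket_leftFrame [CompleteSpace E] : ∀ᶠ e in 𝓝 e₀, ∀ A B : E,
    lieBracket ℝ (fun q ↦ leftFrame E G q A) (fun q ↦ leftFrame E G q B) e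
      = leftFrame E G e (modelBracket E G A B) := by
  have := lieGroup_minSmoothness (E := E) (G := G)
  have : IsManifold 𝓘(ℝ, E) (minSmoothness ℝ 2) G := by
    rw [minSmoothness_of_isRCLikeNormedField]
    infer_instance
  have hpull : ∀ᶠ e in 𝓝 e₀, ∀ A : E,
      (mpullback 𝓘(ℝ, E) 𝓘(ℝ, E) (𝔠).symm
        (mulInvariantVectorField (I := 𝓘(ℝ, E)) (G := G) A) e : E) = leftFrame E G e A := by
    filter_upwards [target_mem_nhds (E := E) (G := G), modelDeriv_symm_leftFrame] with e he h A
    have hinv : (modelDeriv E E (𝔠).symm e).inverse = modelDeriv E E 𝔠 ((𝔠).symm e) := by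
      apply ContinuousLinearMap.inverse_eq
      · ext v
        have := modelDeriv_symm_modelDeriv_extChartAt (1 : G) ((𝔠).map_target he) v
        rwa [(𝔠).right_inv he] at this
      · ext v
        exact modelDeriv_extChartAt_modelDeriv_symm (1 : G) he v
    change (modelDeriv E E (𝔠).symm e).inverse (modelDeriv E E ((𝔠).symm e * ·) 1 A) = _
    rw [← h, hinv, modelDeriv_extChartAt_modelDeriv_symm (1 : G) he]
  filter_upwards [hpull.eventually_nhds, target_mem_nhds (E := E) (G := G)] with e h he A B
  have hs := contMDiffAt_extChartAt_symm (1 : G) he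
  have hb := mpullback_mlieBracket (n := ∞)
    (mdifferentiableAt_mulInvariantVectorField (I := 𝓘(ℝ, E)) (G := G) A (g := (𝔠).symm e))
    (mdifferentiableAt_mulInvariantVectorField (I := 𝓘(ℝ, E)) (G := G) B (g := (𝔠).symm e)) hs
    (by rw [minSmoothness_of_isRCLikeNormedField]; exact ENat.LEInfty.out)
  have hbr := mulInvariantVector_mlieBracket (I := 𝓘(ℝ, E)) (G := G) A B
  replace hb := (congrArg (fun V ↦ mpullback 𝓘(ℝ, E) 𝓘(ℝ, E) (𝔠).symm V e) hbr).trans hb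
  have h1 := h.self_of_nhds (modelBracket E G A B)
  rw [← h1]
  refine Eq.trans ?_ hb.symm
  rw [← mlieBracketWithin_univ, mlieBracketWithin_eq_lieBracketWithin]
  refine Eq.trans ?_ (congrFun lieBracketWithin_univ e).symm
  refine (Filter.EventuallyEq.lieBracket_vectorField_eq ?_ ?_).symm
  · exact h.mono fun q hq ↦ hq A
  · exact h.mono fun q hq ↦ hq B

end GroupChart

section Adjoint

open Filter Topology VectorField

variable {E : Type*} [NormedAddCommGroup E] [NormedSpace ℝ E]
  {G : Type*} [TopologicalSpace G] [ChartedSpace E G] [Group G]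

local notation "𝔠" => extChartAt 𝓘(ℝ, E) (1 : G)
local notation "e₀" => chartOne E G

/-- The Lie bracket of the Lie algebra of `G`, as a continuous bilinear map on the model space. -/
noncomputable def modelBracketL (E G : Type*) [NormedAddCommGroup E] [NormedSpace ℝ E]
    [TopologicalSpace G] [ChartedSpace E G] [Group G] : E →L[ℝ] E →L[ℝ] E :=
  fderiv ℝ (leftFrame E G) (chartOne E G) - (fderiv ℝ (leftFrame E G) (chartOne E G)).flip

theorem modelBracketL_apply (A B : E) : modelBracketL E G A B
    = fderiv ℝ (leftFrame E G) e₀ A B - fderiv ℝ (leftFrame E G) e₀ B A := rfl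

theorem modelBracketL_skew (A B : E) : modelBracketL E G A B = -modelBracketL E G B A := by
  rw [modelBracketL_apply, modelBracketL_apply, neg_sub]

/-- The adjoint representation, on the model space. -/
noncomputable def modelAd (E : Type*) {G : Type*} [NormedAddCommGroup E] [NormedSpace ℝ E]
    [TopologicalSpace G] [ChartedSpace E G] [Group G] (a : G) : E →L[ℝ] E :=
  modelDeriv E E (fun x ↦ a * x * a⁻¹) 1

/-- The vector `Ad (q⁻¹) A`, where `q` is the point with coordinates `e` in the chart at `1`. -/
noncomputable def invAdjoint (G : Type*) [TopologicalSpace G] [ChartedSpace E G] [Group G]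
    (A e : E) : E :=
  (leftFrame E G e).inverse (rightFrame E G e A)

variable [LieGroup 𝓘(ℝ, E) ∞ G]

theorem modelBracketL_eq [CompleteSpace E] (A B : E) :
    modelBracketL E G A B = modelBracket E G A B := by
  have h := (lieBracket_leftFrame (E := E) (G := G)).self_of_nhds A B
  have hd := (contDiffAt_leftFrame (E := E) (G := G)).differentiableAt (by simp)
  have hc (A u : E) : fderiv ℝ (fun q ↦ leftFrame E G q A) e₀ u
      = fderiv ℝ (leftFrame E G) e₀ u A := by
    rw [(hd.hasFDerivAt.clm_apply (hasFDerivAt_const A _)).fderiv]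
    simp
  rw [lieBracket_eq] at h
  simp only [hc, leftFrame_chartOne, ContinuousLinearMap.id_apply] at h
  rw [modelBracketL_apply, ← h]

theorem eventually_lieBracket_leftFrame [CompleteSpace E] : ∀ᶠ e in 𝓝 e₀, ∀ A B : E,
    lieBracket ℝ (fun q ↦ leftFrame E G q A) (fun q ↦ leftFrame E G q B) e
      = leftFrame E G e (modelBracketL E G A B) := by
  filter_upwards [lieBracket_leftFrame (E := E) (G := G)] with e h A B
  rw [h, modelBracketL_eq]

theorem isInvertible_leftFrame [CompleteSpace E] : ∀ᶠ e in 𝓝 e₀, (leftFrame E G e).IsInvertible := by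
  have h := (ContinuousLinearEquiv.refl ℝ E).nhds
  have hc := (contDiffAt_leftFrame (E := E) (G := G)).continuousAt
  rw [ContinuousAt, leftFrame_chartOne] at hc
  exact hc h

theorem contDiffAt_invAdjoint [CompleteSpace E] (A : E) : ContDiffAt ℝ ∞ (invAdjoint G A) e₀ := by
  have h1 : ContDiffAt ℝ ∞ (fun e ↦ (leftFrame E G e).inverse) e₀ :=
    isInvertible_leftFrame.self_of_nhds.contDiffAt_map_inverse.comp e₀ contDiffAt_leftFrame
  exact h1.clm_apply (contDiffAt_rightFrame.clm_apply contDiffAt_const)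

theorem invAdjoint_chartOne (A : E) : invAdjoint G A e₀ = A := by
  rw [invAdjoint, leftFrame_chartOne, rightFrame_chartOne, ContinuousLinearMap.inverse_id]
  rfl

/-- The differential of the adjoint representation is given by the Lie bracket. -/
theorem fderiv_invAdjoint [CompleteSpace E] (A B : E) :
    fderiv ℝ (invAdjoint G A) e₀ B = -modelBracketL E G B A := by
  have hl := ((contDiffAt_leftFrame (E := E) (G := G)).differentiableAt (by simp)).hasFDerivAt
  have hr := ((contDiffAt_rightFrame (E := E) (G := G)).differentiableAt (by simp)).hasFDerivAt
  have hi := ((contDiffAt_invAdjoint (G := G) A).differentiableAt (by simp)).hasFDerivAt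
  have hμ : ContDiffAt ℝ 2 (chartMul E G) (e₀, e₀) := contDiffAt_chartMul.of_le ENat.LEInfty.out
  have dμ : HasFDerivAt (fderiv ℝ (chartMul E G)) (fderiv ℝ (fderiv ℝ (chartMul E G)) (e₀, e₀))
      (e₀, e₀) := ((hμ.fderiv_right (m := 1) (by norm_num)).differentiableAt (by simp)).hasFDerivAt
  have key1 (u v : E) : fderiv ℝ (leftFrame E G) e₀ u v
      = fderiv ℝ (fderiv ℝ (chartMul E G)) (e₀, e₀) (u, 0) (0, v) := by
    have h1 : HasFDerivAt (fun e ↦ fderiv ℝ (chartMul E G) (e, e₀))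
        (fderiv ℝ (fderiv ℝ (chartMul E G)) (e₀, e₀) ∘L ContinuousLinearMap.inl ℝ E E) e₀ :=
      HasFDerivAt.comp (f := fun e : E ↦ (e, e₀)) e₀ dμ (hasFDerivAt_prodMk_left e₀ e₀)
    have h2 := h1.clm_comp (hasFDerivAt_const (ContinuousLinearMap.inr ℝ E E) e₀)
    refine (congrArg (fun T : E →L[ℝ] E →L[ℝ] E ↦ T u v) h2.fderiv).trans ?_
    simp
  have key2 (u v : E) : fderiv ℝ (rightFrame E G) e₀ u v
      = fderiv ℝ (fderiv ℝ (chartMul E G)) (e₀, e₀) (0, u) (v, 0) := by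
    have h1 : HasFDerivAt (fun e ↦ fderiv ℝ (chartMul E G) (e₀, e))
        (fderiv ℝ (fderiv ℝ (chartMul E G)) (e₀, e₀) ∘L ContinuousLinearMap.inr ℝ E E) e₀ :=
      HasFDerivAt.comp (f := fun e : E ↦ (e₀, e)) e₀ dμ (hasFDerivAt_prodMk_right e₀ e₀)
    have h2 := h1.clm_comp (hasFDerivAt_const (ContinuousLinearMap.inl ℝ E E) e₀)
    refine (congrArg (fun T : E →L[ℝ] E →L[ℝ] E ↦ T u v) h2.fderiv).trans ?_
    simp
  have hev : (fun e ↦ leftFrame E G e (invAdjoint G A e)) =ᶠ[𝓝 e₀] fun e ↦ rightFrame E G e A := by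
    filter_upwards [isInvertible_leftFrame (E := E) (G := G)] with e he
    exact he.self_apply_inverse _
  have h := hev.fderiv_eq (𝕜 := ℝ)
  rw [(hl.clm_apply hi).fderiv, (hr.clm_apply (hasFDerivAt_const (𝕜 := ℝ) A e₀)).fderiv] at h
  have h' := congrArg (fun T : E →L[ℝ] E ↦ T B) h
  simp only [add_apply, ContinuousLinearMap.comp_apply, ContinuousLinearMap.flip_apply,
    leftFrame_chartOne, invAdjoint_chartOne, ContinuousLinearMap.id_apply, zero_apply, map_zero,
    zero_add] at h'
  have hsymm : fderiv ℝ (fderiv ℝ (chartMul E G)) (e₀, e₀) (0, B) (A, 0)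
      = fderiv ℝ (fderiv ℝ (chartMul E G)) (e₀, e₀) (A, 0) (0, B) :=
    (hμ.isSymmSndFDerivAt (by simp)).eq _ _
  rw [key2, hsymm, ← key1] at h'
  rw [modelBracketL_apply, neg_sub, ← h']
  abel

theorem mdifferentiableAt_conj (a x : G) :
    MDifferentiableAt 𝓘(ℝ, E) 𝓘(ℝ, E) (fun x ↦ a * x * a⁻¹) x :=
  (mdifferentiableAt_rightMul (E := E) a⁻¹ (a * x)).comp x (mdifferentiableAt_leftMul a x)

theorem modelAd_mul (a b : G) : modelAd E (a * b) = modelAd E a ∘L modelAd E b := by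
  have h : (fun x : G ↦ a * b * x * (a * b)⁻¹) = (fun x ↦ a * x * a⁻¹) ∘ fun x ↦ b * x * b⁻¹ := by
    ext x
    simp [mul_assoc]
  rw [modelAd, h, modelDeriv_comp 1 (mdifferentiableAt_conj a _) (mdifferentiableAt_conj b 1)]
  simp only [mul_one, mul_inv_cancel]
  rfl

theorem modelDeriv_leftMul_modelAd (q : G) :
    modelDeriv E E (q * ·) 1 ∘L modelAd E q⁻¹ = modelDeriv E E (· * q) (1 : G) := by
  have h : (fun x : G ↦ x * q) = (fun x ↦ q * x) ∘ fun x ↦ q⁻¹ * x * q⁻¹⁻¹ := by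
    ext x
    simp [mul_assoc]
  rw [h, modelDeriv_comp 1 (mdifferentiableAt_leftMul _ _)
    (mdifferentiableAt_conj _ _)]
  simp only [mul_one, mul_inv_cancel]
  rfl

theorem modelDeriv_leftMul_leftMul (a b : G) :
    modelDeriv E E (a * ·) b ∘L modelDeriv E E (b * ·) 1 = modelDeriv E E (a * b * ·) (1 : G) := by
  have h : (fun x : G ↦ a * b * x) = (fun x ↦ a * x) ∘ fun x ↦ b * x := by
    ext x
    simp [mul_assoc]
  rw [h, modelDeriv_comp 1 (mdifferentiableAt_leftMul _ _) (mdifferentiableAt_leftMul _ _), mul_one]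

theorem injective_modelDeriv_leftMul (q : G) :
    Function.Injective (modelDeriv E E (q * ·) (1 : G)) := by
  have h := modelDeriv_leftMul_leftMul (E := E) q⁻¹ q
  have h1 : (fun x : G ↦ q⁻¹ * q * x) = id := by
    ext x
    simp
  rw [h1, modelDeriv_id] at h
  intro v w hvw
  have hv := congrArg (fun T : E →L[ℝ] E ↦ T v) h
  have hw := congrArg (fun T : E →L[ℝ] E ↦ T w) h
  simp only [ContinuousLinearMap.comp_apply, ContinuousLinearMap.id_apply] at hv hw
  rw [← hv, ← hw, hvw]

theorem eventually_invAdjoint [CompleteSpace E] : ∀ᶠ e in 𝓝 e₀, ∀ A : E,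
    invAdjoint G A e = modelAd E ((𝔠).symm e)⁻¹ A := by
  filter_upwards [isInvertible_leftFrame (E := E) (G := G), modelDeriv_symm_leftFrame,
    modelDeriv_symm_rightFrame] with e hi hl hr A
  apply injective_modelDeriv_leftMul ((𝔠).symm e)
  rw [← hl, invAdjoint, hi.self_apply_inverse, hr, ← modelDeriv_leftMul_modelAd]
  rfl

end Adjoint

section InvariantMetrics

open Filter Topology

variable {E : Type*} [NormedAddCommGroup E] [NormedSpace ℝ E]
  {G : Type*} [TopologicalSpace G] [ChartedSpace E G] [Group G] [LieGroup 𝓘(ℝ, E) ∞ G]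

local notation "𝔠" => extChartAt 𝓘(ℝ, E) (1 : G)
local notation "e₀" => chartOne E G

/-- The scalar product at `x` of a Riemannian metric, on the model space. -/
noncomputable def modelInner {E : Type*} [NormedAddCommGroup E] [NormedSpace ℝ E] {M : Type*}
    [TopologicalSpace M] [ChartedSpace E M] [IsManifold 𝓘(ℝ, E) ∞ M] (m : SmoothMetric E M)
    (x : M) : E →L[ℝ] E →L[ℝ] ℝ :=
  m.inner x

theorem modelInner_modelAd {m : SmoothMetric E G} (hm : IsLeftInvariant m) {a : G}
    (ha : IsRightIsometry m a⁻¹) (v w : E) :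
    modelInner m 1 (modelAd E a v) (modelAd E a w) = modelInner m 1 v w := by
  have h : (fun x : G ↦ a * x * a⁻¹) = (fun x ↦ x * a⁻¹) ∘ fun x ↦ a * x := rfl
  have h1 : ∀ v w : E, modelInner m (a * 1 * a⁻¹) (modelDeriv E E (· * a⁻¹) (a * 1) v)
    (modelDeriv E E (· * a⁻¹) (a * 1) w) = modelInner m (a * 1) v w := ha (a * 1)
  have h2 : ∀ v w : E, modelInner m (a * 1) (modelDeriv E E (a * ·) 1 v)
    (modelDeriv E E (a * ·) 1 w) = modelInner m 1 v w := hm a 1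
  have h3 : a * 1 * a⁻¹ = 1 := by simp
  rw [modelAd, h, modelDeriv_comp 1 (mdifferentiableAt_rightMul _ _) (mdifferentiableAt_leftMul _ _)]
  rw [h3] at h1
  exact (h1 _ _).trans (h2 v w)

/-- If `e ↦ Ad (q⁻¹)` preserves the scalar product `Q` along the curve `f`, then so does its
derivative, infinitesimally. -/
theorem bracket_skew_of_curve [CompleteSpace E] {Q : E →L[ℝ] E →L[ℝ] ℝ} {f : ℝ → E} {X : E}
    (hf : HasDerivAt f X 0) (hf0 : f 0 = e₀)
    (hQ : ∀ᶠ t in 𝓝 0, ∀ A B, Q (invAdjoint G A (f t)) (invAdjoint G B (f t)) = Q A B) (A B : E) :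
    Q (modelBracketL E G X A) B = -Q A (modelBracketL E G X B) := by
  have hd (A : E) : HasDerivAt (fun t ↦ invAdjoint G A (f t)) (-modelBracketL E G X A) 0 := by
    have h1 : HasFDerivAt (invAdjoint G A) (fderiv ℝ (invAdjoint G A) e₀) (f 0) := by
      rw [hf0]
      exact ((contDiffAt_invAdjoint (G := G) A).differentiableAt (by simp)).hasFDerivAt
    rw [← fderiv_invAdjoint]
    exact h1.comp_hasDerivAt 0 hf
  have h2 := (Q.hasFDerivAt.comp_hasDerivAt 0 (hd A)).clm_apply (hd B)
  have hev : (fun t ↦ Q (invAdjoint G A (f t)) (invAdjoint G B (f t))) =ᶠ[𝓝 0] fun _ ↦ Q A B := by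
    filter_upwards [hQ] with t ht using ht A B
  have h3 := h2.unique ((hasDerivAt_const 0 (Q A B)).congr_of_eventuallyEq hev)
  simp only [Function.comp_apply, hf0, invAdjoint_chartOne, map_neg, neg_apply] at h3
  linarith

/-- Derivatives of curves in a subspace belong to the subspace. -/
theorem bracket_mem_of_curve [FiniteDimensional ℝ E] {V : Submodule ℝ E} {f : ℝ → E} {X A : E}
    (hf : HasDerivAt f X 0) (hf0 : f 0 = e₀) (hV : ∀ᶠ t in 𝓝 0, invAdjoint G A (f t) ∈ V) :
    modelBracketL E G X A ∈ V := by
  have := FiniteDimensional.complete ℝ E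
  have h1 : HasFDerivAt (invAdjoint G A) (fderiv ℝ (invAdjoint G A) e₀) (f 0) := by
    rw [hf0]
    exact ((contDiffAt_invAdjoint (G := G) A).differentiableAt (by simp)).hasFDerivAt
  have h2 := h1.comp_hasDerivAt 0 hf
  rw [fderiv_invAdjoint] at h2
  rw [← Subspace.forall_mem_dualAnnihilator_apply_eq_zero_iff]
  intro φ hφ
  have h3 := (LinearMap.toContinuousLinearMap φ).hasFDerivAt.comp_hasDerivAt 0 h2
  have hev : (LinearMap.toContinuousLinearMap φ ∘ invAdjoint G A ∘ f) =ᶠ[𝓝 0] fun _ ↦ 0 := by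
    filter_upwards [hV] with t ht
    exact (Submodule.mem_dualAnnihilator φ).1 hφ _ ht
  have h4 := h3.unique ((hasDerivAt_const 0 (0 : ℝ)).congr_of_eventuallyEq hev)
  simpa using h4

theorem IsOneParameterSubgroup.map_zero {γ : ℝ → G} {X : GroupLieAlgebra 𝓘(ℝ, E) G}
    (h : IsOneParameterSubgroup γ X) : γ 0 = 1 := by
  have := h.map_add 0 0
  rwa [add_zero, left_eq_mul] at this

theorem IsOneParameterSubgroup.mdifferentiableAt {γ : ℝ → G} {X : GroupLieAlgebra 𝓘(ℝ, E) G}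
    (h : IsOneParameterSubgroup γ X) (t : ℝ) : MDifferentiableAt 𝓘(ℝ, ℝ) 𝓘(ℝ, E) γ t :=
  h.smooth.contMDiffAt.mdifferentiableAt (by simp)

theorem IsOneParameterSubgroup.hasDerivAt {γ : ℝ → G} {X : E}
    (h : IsOneParameterSubgroup (E := E) γ X) : HasDerivAt (fun t ↦ 𝔠 (γ t)) X 0 := by
  have hc : MDifferentiableAt 𝓘(ℝ, E) 𝓘(ℝ, E) 𝔠 (γ 0) := by
    rw [h.map_zero]
    exact mdifferentiableAt_extChartAt (mem_chart_source E (1 : G))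
  have hd : DifferentiableAt ℝ (fun t ↦ 𝔠 (γ t)) 0 :=
    mdifferentiableAt_iff_differentiableAt.1 (hc.comp 0 (h.mdifferentiableAt 0))
  have h1 := modelDeriv_comp (E := ℝ) 0 hc (h.mdifferentiableAt 0)
  rw [modelDeriv_eq_fderiv, h.map_zero, modelDeriv_extChartAt_self] at h1
  have h2 : modelDeriv ℝ E γ 0 1 = X := h.velocity
  have h3 := hd.hasFDerivAt.hasDerivAt
  have h4 : fderiv ℝ (fun t ↦ 𝔠 (γ t)) 0 1 = X := by
    refine (congrArg (fun T : ℝ →L[ℝ] E ↦ T 1) h1).trans ?_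
    rw [← h2]
    rfl
  rwa [h4] at h3

/-- Near `0`, a one-parameter subgroup is given by its expression in the chart at `1`. -/
theorem IsOneParameterSubgroup.eventually_invAdjoint [CompleteSpace E] {γ : ℝ → G} {X : E}
    (h : IsOneParameterSubgroup (E := E) γ X) :
    ∀ᶠ t in 𝓝 0, ∀ A : E, invAdjoint G A (𝔠 (γ t)) = modelAd E (γ t)⁻¹ A := by
  have h1 : Tendsto (fun t ↦ 𝔠 (γ t)) (𝓝 0) (𝓝 e₀) := by
    have := h.hasDerivAt.continuousAt
    rwa [ContinuousAt, h.map_zero] at this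
  have h2 : ∀ᶠ t in 𝓝 0, γ t ∈ (𝔠).source := by
    refine (h.mdifferentiableAt 0).continuousAt ?_
    rw [h.map_zero]
    exact extChartAt_source_mem_nhds (1 : G)
  filter_upwards [h1.eventually (_root_.eventually_invAdjoint (E := E) (G := G)), h2] with t ht hs A
  rw [ht, (𝔠).left_inv hs]

theorem bracket_skew_of_biInvariant [CompleteSpace E] {Q : SmoothMetric E G} (hQ : IsBiInvariant Q)
    (A B C : E) : modelInner Q 1 (modelBracketL E G A B) C
      = -modelInner Q 1 B (modelBracketL E G A C) := by
  have hf : HasDerivAt (fun t : ℝ ↦ e₀ + t • A) A 0 := by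
    simpa using ((hasDerivAt_id (0 : ℝ)).smul_const A).const_add e₀
  refine bracket_skew_of_curve hf (by simp) ?_ B C
  have h1 : Tendsto (fun t : ℝ ↦ e₀ + t • A) (𝓝 0) (𝓝 e₀) := by
    have := hf.continuousAt
    rwa [ContinuousAt, zero_smul, add_zero] at this
  filter_upwards [h1.eventually (eventually_invAdjoint (E := E) (G := G))] with t ht A B
  rw [ht, ht]
  exact modelInner_modelAd hQ.1 (hQ.2 _) A B

theorem bracket_skew_of_invariance [CompleteSpace E] {m : SmoothMetric E G} (hm : IsLeftInvariant m)
    {X : E} (hX : X ∈ lieAlgebraOf (E := E) (invarianceGroup m)) (A B : E) :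
    modelInner m 1 (modelBracketL E G X A) B = -modelInner m 1 A (modelBracketL E G X B) := by
  obtain ⟨γ, hγ, hK⟩ := hX
  refine bracket_skew_of_curve hγ.hasDerivAt (by rw [hγ.map_zero]; rfl) ?_ A B
  filter_upwards [hγ.eventually_invAdjoint] with t ht A B
  rw [ht, ht]
  exact modelInner_modelAd hm (by rw [inv_inv]; exact hK t) A B

theorem bracket_mem_of_invariance [FiniteDimensional ℝ E] {m : SmoothMetric E G}
    {V : Submodule ℝ E} (hV : ∀ k ∈ invarianceGroup m, ∀ A ∈ V, modelAd E k A ∈ V)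
    {X : E} (hX : X ∈ lieAlgebraOf (E := E) (invarianceGroup m)) {A : E} (hA : A ∈ V) :
    modelBracketL E G X A ∈ V := by
  have := FiniteDimensional.complete ℝ E
  obtain ⟨γ, hγ, hK⟩ := hX
  refine bracket_mem_of_curve hγ.hasDerivAt (by rw [hγ.map_zero]; rfl) ?_
  filter_upwards [hγ.eventually_invAdjoint] with t ht
  rw [ht]
  exact hV _ (inv_mem (hK t)) A hA

end InvariantMetrics

theorem exists_mem_orthogonal_sub {V : Type*} [NormedAddCommGroup V] [NormedSpace ℝ V]
    [FiniteDimensional ℝ V] {m : V →L[ℝ] V →L[ℝ] ℝ} (hm : ∀ v, v ≠ 0 → 0 < m v v)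
    (W : Submodule ℝ V) (A : V) : ∃ w ∈ W, ∀ z ∈ W, m (A - w) z = 0 := by
  let mW : W →L[ℝ] W →L[ℝ] ℝ := ContinuousLinearMap.precomp ℝ W.subtypeL ∘L m ∘L W.subtypeL
  have hmW : mW.IsInvertible := isInvertible_of_pos fun v hv ↦ hm v (by simpa using hv)
  obtain ⟨w, hw⟩ := hmW.surjective (m A ∘L W.subtypeL)
  refine ⟨w, w.2, fun z hz ↦ ?_⟩
  have h1 : m w z = m A z := congrArg (fun T : W →L[ℝ] ℝ ↦ T ⟨z, hz⟩) hw
  rw [map_sub, sub_apply, h1, sub_self]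

section Biquotient

open Filter Topology

variable {E : Type*} [NormedAddCommGroup E] [NormedSpace ℝ E]
  {G : Type*} [TopologicalSpace G] [ChartedSpace E G] [Group G]
  {F : Type*} [NormedAddCommGroup F] [NormedSpace ℝ F]

local notation "𝔠" => extChartAt 𝓘(ℝ, E) (1 : G)
local notation "e₀" => chartOne E G

/-- The differential at `g` of the projection to the biquotient, composed with the left translation
from the Lie algebra. -/
noncomputable def projDeriv (E F : Type*) [NormedAddCommGroup E] [NormedSpace ℝ E]
    [NormedAddCommGroup F] [NormedSpace ℝ F]
    {G : Type*} [TopologicalSpace G] [ChartedSpace E G] [Group G] (U : Subgroup (G × G))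
    [ChartedSpace F (Biquotient U)] (g : G) : E →L[ℝ] F :=
  modelDeriv E F (biquotientProj U) g ∘L modelDeriv E E (g * ·) 1

/-- The vertical space, as a subspace of the model space. -/
noncomputable def modelVertical (E : Type*) [NormedAddCommGroup E] [NormedSpace ℝ E]
    {G : Type*} [TopologicalSpace G] [ChartedSpace E G] [Group G] (U : Subgroup (G × G)) (g : G) :
    Submodule ℝ E :=
  Submodule.span ℝ {Z : E | ∃ X : E × E, X ∈ lieAlgebraOfProd (E := E) U ∧ Z = modelAd E g⁻¹ X.1 - X.2}

variable [LieGroup 𝓘(ℝ, E) ∞ G]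

theorem modelDeriv_curve_mul {a b : ℝ → G} (ha : MDifferentiableAt 𝓘(ℝ, ℝ) 𝓘(ℝ, E) a 0)
    (hb : MDifferentiableAt 𝓘(ℝ, ℝ) 𝓘(ℝ, E) b 0) (t : ℝ) :
    modelDeriv ℝ E (fun t ↦ a t * b t) 0 t
      = modelDeriv E E (· * b 0) (a 0) (modelDeriv ℝ E a 0 t)
        + modelDeriv E E (a 0 * ·) (b 0) (modelDeriv ℝ E b 0 t) := by
  have hmul : MDifferentiableAt (𝓘(ℝ, E).prod 𝓘(ℝ, E)) 𝓘(ℝ, E) (fun p : G × G ↦ p.1 * p.2)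
      (a 0, b 0) := (contMDiff_mul 𝓘(ℝ, E) ∞).contMDiffAt.mdifferentiableAt (by simp)
  have h1 := mfderiv_comp (I := 𝓘(ℝ, ℝ)) (f := fun t ↦ (a t, b t)) 0 hmul (ha.prodMk hb)
  rw [mfderiv_prodMk ha hb] at h1
  have h2 := mfderiv_prod_eq_add_apply (v := (modelDeriv ℝ E a 0 t, modelDeriv ℝ E b 0 t)) hmul
  exact (congrArg (fun T : ℝ →L[ℝ] E ↦ T t) h1).trans h2

variable {U : Subgroup (G × G)} [ChartedSpace F (Biquotient U)]

/-- Vertical vectors are in the kernel of the differential of the projection. -/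
theorem projDeriv_vertical (hquot : IsQuotientManifold E F U) (g : G) {X : E × E}
    (hX : X ∈ lieAlgebraOfProd (E := E) U) :
    projDeriv E F U g (modelAd E g⁻¹ X.1 - X.2) = 0 := by
  obtain ⟨γL, γR, hL, hR, hU⟩ := hX
  have dL := hL.mdifferentiableAt 0
  have dR := hR.mdifferentiableAt 0
  have vL : modelDeriv ℝ E γL 0 1 = X.1 := hL.velocity
  have vR : modelDeriv ℝ E γR 0 1 = X.2 := hR.velocity
  have dR' : MDifferentiableAt 𝓘(ℝ, ℝ) 𝓘(ℝ, E) (fun t ↦ (γR t)⁻¹) 0 :=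
    (hR.smooth.inv).contMDiffAt.mdifferentiableAt (by simp)
  have dLg : MDifferentiableAt 𝓘(ℝ, ℝ) 𝓘(ℝ, E) (fun t ↦ γL t * g) 0 :=
    (mdifferentiableAt_rightMul g _).comp 0 dL
  let δ : ℝ → G := fun t ↦ γL t * g * (γR t)⁻¹
  have dδ : MDifferentiableAt 𝓘(ℝ, ℝ) 𝓘(ℝ, E) δ 0 :=
    MDifferentiableAt.comp (I' := 𝓘(ℝ, E).prod 𝓘(ℝ, E)) (g := fun p : G × G ↦ p.1 * p.2)
      (f := fun t ↦ (γL t * g, (γR t)⁻¹)) 0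
      ((contMDiff_mul 𝓘(ℝ, E) ∞).contMDiffAt.mdifferentiableAt (by simp)) (dLg.prodMk dR')
  have δ0 : δ 0 = g := by simp [δ, hL.map_zero, hR.map_zero]
  -- the velocity of the orbit
  have vδ : modelDeriv ℝ E δ 0 1 = modelDeriv E E (g * ·) 1 (modelAd E g⁻¹ X.1 - X.2) := by
    have h1 := modelDeriv_curve_mul dδ dR 1
    have h2 : (fun t ↦ δ t * γR t) = (fun x ↦ x * g) ∘ γL := by
      ext t
      simp [δ]
    have h3 : (fun x : G ↦ x * 1) = id := funext mul_one
    rw [h2, modelDeriv_comp 0 (mdifferentiableAt_rightMul g _) dL, ContinuousLinearMap.comp_apply,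
      vL, vR, δ0, hR.map_zero, hL.map_zero, h3, modelDeriv_id, ← modelDeriv_leftMul_modelAd] at h1
    rw [map_sub, eq_sub_iff_add_eq]
    exact h1.symm
  have hconst : biquotientProj U ∘ δ = fun _ ↦ biquotientProj U g := by
    ext t
    exact (Quotient.sound ⟨_, hU t, rfl⟩ : biquotientProj U g = biquotientProj U (δ t)).symm
  have h4 := modelDeriv_comp (E := ℝ) (F := E) (H := F) (g := biquotientProj U) (f := δ) 0
    (hquot.1.contMDiffAt.mdifferentiableAt (by simp)) dδ
  rw [hconst, modelDeriv_const, δ0] at h4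
  rw [projDeriv, ContinuousLinearMap.comp_apply, ← vδ]
  exact (congrArg (fun T : ℝ →L[ℝ] F ↦ T 1) h4).symm

theorem projDeriv_of_mem_vertical (hquot : IsQuotientManifold E F U) (g : G) {Z : E}
    (hZ : Z ∈ modelVertical E U g) : projDeriv E F U g Z = 0 := by
  refine Submodule.span_induction (fun Z₀ h₀ ↦ ?_) (map_zero _)
      (fun x y _ _ hx hy ↦ by rw [map_add, hx, hy, add_zero])
      (fun a x _ hx ↦ by rw [map_smul, hx, smul_zero]) hZ
  obtain ⟨X, hX, rfl⟩ := h₀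
  exact projDeriv_vertical hquot g hX

variable [FiniteDimensional ℝ E] [IsManifold 𝓘(ℝ, F) ∞ (Biquotient U)]
  {m : SmoothMetric E G} {mB : SmoothMetric F (Biquotient U)}

theorem projDeriv_surjective (hquot : IsQuotientManifold E F U) (g : G) :
    Function.Surjective (projDeriv E F U g) := by
  have h1 : Function.Surjective (modelDeriv E E (g * ·) (1 : G)) :=
    LinearMap.injective_iff_surjective.1 (injective_modelDeriv_leftMul (E := E) g)
  have h2 : Function.Surjective (modelDeriv E F (biquotientProj U) g) := hquot.2 g
  exact h2.comp h1

theorem modelInner_pos {M : Type*} [TopologicalSpace M] [ChartedSpace E M]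
    [IsManifold 𝓘(ℝ, E) ∞ M] (m : SmoothMetric E M) (x : M) (v : E) (hv : v ≠ 0) :
    0 < modelInner m x v v :=
  m.pos x v hv

theorem modelInner_symm {M : Type*} [TopologicalSpace M] [ChartedSpace E M]
    [IsManifold 𝓘(ℝ, E) ∞ M] (m : SmoothMetric E M) (x : M) (v w : E) :
    modelInner m x v w = modelInner m x w v :=
  m.symm x v w

theorem modelInner_projDeriv_of_horizontal (hmB : IsInducedMetric m U mB) (g : G) {X Y : E}
    (hX : ∀ Z ∈ modelVertical E U g, modelInner m 1 X Z = 0)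
    (hY : ∀ Z ∈ modelVertical E U g, modelInner m 1 Y Z = 0) :
    modelInner mB (biquotientProj U g) (projDeriv E F U g X) (projDeriv E F U g Y)
      = modelInner m 1 X Y :=
  hmB g X Y hX hY

theorem mem_vertical_of_projDeriv (hquot : IsQuotientManifold E F U) (hmB : IsInducedMetric m U mB)
    (g : G) {Z : E} (hZ : projDeriv E F U g Z = 0) : Z ∈ modelVertical E U g := by
  obtain ⟨w, hw, hZw⟩ := exists_mem_orthogonal_sub (modelInner_pos m 1) (modelVertical E U g) Z
  have h1 := modelInner_projDeriv_of_horizontal hmB g hZw hZw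
  have h0 : projDeriv E F U g (Z - w) = 0 := by
    rw [map_sub, hZ, projDeriv_of_mem_vertical hquot g hw, sub_zero]
  rw [h0, map_zero] at h1
  by_contra hne
  refine (modelInner_pos m 1 (Z - w) fun h0 ↦ hne ?_).ne h1
  rwa [sub_eq_zero.1 h0]

/-- The differential of the projection is isometric on the complement of its kernel. -/
theorem modelInner_projDeriv (hquot : IsQuotientManifold E F U) (hmB : IsInducedMetric m U mB)
    (g : G) {X : E} (hX : ∀ Z, projDeriv E F U g Z = 0 → modelInner m 1 X Z = 0) (A : E) :
    modelInner mB (biquotientProj U g) (projDeriv E F U g X) (projDeriv E F U g A)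
      = modelInner m 1 X A := by
  obtain ⟨w, hw, hAw⟩ := exists_mem_orthogonal_sub (modelInner_pos m 1) (modelVertical E U g) A
  have hw0 := projDeriv_of_mem_vertical hquot g hw
  have h1 := modelInner_projDeriv_of_horizontal hmB g
    (fun Z hZ ↦ hX Z (projDeriv_of_mem_vertical hquot g hZ)) hAw
  have h2 : projDeriv E F U g (A - w) = projDeriv E F U g A := by rw [map_sub, hw0, sub_zero]
  have h3 : modelInner m 1 X (A - w) = modelInner m 1 X A := by
    rw [map_sub, hX w hw0, sub_zero]
  rwa [h2, h3] at h1

/-- The projection to the biquotient in the preferred charts at `1` and at the orbit of `g`,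
precomposed with the left translation by `g`. -/
noncomputable def chartProj (E F : Type*) [NormedAddCommGroup E] [NormedSpace ℝ E]
    [NormedAddCommGroup F] [NormedSpace ℝ F]
    {G : Type*} [TopologicalSpace G] [ChartedSpace E G] [Group G] (U : Subgroup (G × G))
    [ChartedSpace F (Biquotient U)] (g : G) (e : E) : F :=
  extChartAt 𝓘(ℝ, F) (biquotientProj U g)
    (biquotientProj U (g * (extChartAt 𝓘(ℝ, E) (1 : G)).symm e))

theorem chartProj_chartOne (g : G) : chartProj E F U g e₀
    = extChartAt 𝓘(ℝ, F) (biquotientProj U g) (biquotientProj U g) := by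
  rw [chartProj, extChartAt_symm_chartOne, mul_one]

theorem contMDiffAt_proj_leftMul (hquot : IsQuotientManifold E F U) (g : G) {e : E}
    (he : e ∈ (𝔠).target) : ContMDiffAt 𝓘(ℝ, E) 𝓘(ℝ, F) ∞
      (fun e ↦ biquotientProj U (g * (𝔠).symm e)) e :=
  hquot.1.contMDiffAt.comp e
    ((contMDiff_mul_left (I := 𝓘(ℝ, E)) (n := ∞) (a := g)).contMDiffAt.comp e
      (contMDiffAt_extChartAt_symm (1 : G) he))

theorem eventually_mem_source (hquot : IsQuotientManifold E F U) (g : G) :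
    ∀ᶠ e in 𝓝 e₀, biquotientProj U (g * (𝔠).symm e)
      ∈ (extChartAt 𝓘(ℝ, F) (biquotientProj U g)).source := by
  refine (contMDiffAt_proj_leftMul hquot g chartOne_mem_target).continuousAt ?_
  rw [extChartAt_symm_chartOne, mul_one]
  exact extChartAt_source_mem_nhds _

theorem contDiffAt_chartProj (hquot : IsQuotientManifold E F U) (g : G) :
    ContDiffAt ℝ ∞ (chartProj E F U g) e₀ := by
  rw [← contMDiffAt_iff_contDiffAt]
  exact (contMDiffAt_extChartAt_of_mem (biquotientProj U g)
    (eventually_mem_source hquot g).self_of_nhds).comp e₀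
    (contMDiffAt_proj_leftMul hquot g chartOne_mem_target)

theorem fderiv_chartProj (hquot : IsQuotientManifold E F U) (g : G) : ∀ᶠ e in 𝓝 e₀, ∀ A : E,
    fderiv ℝ (chartProj E F U g) e (leftFrame E G e A)
      = modelDeriv F F (extChartAt 𝓘(ℝ, F) (biquotientProj U g))
        (biquotientProj U (g * (𝔠).symm e)) (projDeriv E F U (g * (𝔠).symm e) A) := by
  filter_upwards [eventually_mem_source hquot g, target_mem_nhds (E := E) (G := G),
    modelDeriv_symm_leftFrame] with e hs he hl A
  have d1 := (contMDiffAt_extChartAt_of_mem (biquotientProj U g) hs).mdifferentiableAt (by simp)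
  have d2 := (contMDiffAt_proj_leftMul hquot g he).mdifferentiableAt (by simp)
  have d3 : MDifferentiableAt 𝓘(ℝ, E) 𝓘(ℝ, F) (biquotientProj U) (g * (𝔠).symm e) :=
    hquot.1.contMDiffAt.mdifferentiableAt (by simp)
  have d5 := (contMDiffAt_extChartAt_symm (1 : G) he).mdifferentiableAt (by simp)
  have d4 : MDifferentiableAt 𝓘(ℝ, E) 𝓘(ℝ, E) ((g * ·) ∘ (𝔠).symm) e :=
    (mdifferentiableAt_leftMul g _).comp e d5
  have h1 := modelDeriv_comp (E := E) e d1 d2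
  have h2 := modelDeriv_comp (E := E) (f := (g * ·) ∘ (𝔠).symm) e d3 d4
  have h3 := modelDeriv_comp (E := E) e (mdifferentiableAt_leftMul g _) d5
  have h4 := modelDeriv_leftMul_leftMul (E := E) g ((𝔠).symm e)
  have h5 : fderiv ℝ (chartProj E F U g) e = modelDeriv E F (chartProj E F U g) e :=
    modelDeriv_eq_fderiv.symm
  rw [h5]
  refine (congrArg (fun T : E →L[ℝ] F ↦ T (leftFrame E G e A)) h1).trans ?_
  rw [ContinuousLinearMap.comp_apply]
  congr 1
  refine (congrArg (fun T : E →L[ℝ] F ↦ T (leftFrame E G e A)) h2).trans ?_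
  rw [h3, projDeriv, ← h4]
  simp only [ContinuousLinearMap.comp_apply]
  rw [hl]
  rfl

theorem isFramedSubmersion_chartProj [FiniteDimensional ℝ F] (hquot : IsQuotientManifold E F U)
    (hmB : IsInducedMetric m U mB) (g : G) :
    IsFramedSubmersion (modelInner m 1) (leftFrame E G) (chartProj E F U g) e₀
      (chartMetric mB (biquotientProj U g)) where
  contDiffAt := contDiffAt_chartProj hquot g
  contDiffAt_metric := by
    rw [chartProj_chartOne]
    exact contDiffAt_chartMetric mB _
  isInvertible := by
    rw [chartProj_chartOne]
    filter_upwards [extChartAt_target_mem_nhds (I := 𝓘(ℝ, F)) (biquotientProj U g)] with q hq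
    exact isInvertible_of_pos (chartMetric_pos mB _ hq)
  symm := Eventually.of_forall fun q ↦ chartMetric_symm mB _ q
  surjective := by
    filter_upwards [fderiv_chartProj hquot g, eventually_mem_source hquot g] with e h hs v
    obtain ⟨A, hA⟩ := projDeriv_surjective hquot (g * (𝔠).symm e)
      (modelDeriv F F (extChartAt 𝓘(ℝ, F) (biquotientProj U g)).symm (chartProj E F U g e) v)
    refine ⟨A, ?_⟩
    have h1 := modelDeriv_extChartAt_modelDeriv_symm (biquotientProj U g)
      ((extChartAt 𝓘(ℝ, F) (biquotientProj U g)).map_source hs) v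
    rw [(extChartAt 𝓘(ℝ, F) (biquotientProj U g)).left_inv hs] at h1
    dsimp only
    rw [h, hA]
    exact h1
  isometry := by
    filter_upwards [fderiv_chartProj hquot g, eventually_mem_source hquot g] with e h hs X hX A
    have hinv := modelDeriv_symm_modelDeriv_extChartAt (biquotientProj U g) hs
    have hb : ∀ v w : F, chartMetric mB (biquotientProj U g) (chartProj E F U g e)
        (modelDeriv F F (extChartAt 𝓘(ℝ, F) (biquotientProj U g))
          (biquotientProj U (g * (𝔠).symm e)) v)
        (modelDeriv F F (extChartAt 𝓘(ℝ, F) (biquotientProj U g))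
          (biquotientProj U (g * (𝔠).symm e)) w)
        = modelInner mB (biquotientProj U (g * (𝔠).symm e)) v w := by
      intro v w
      have h1 : ∀ (y : Biquotient U), y = biquotientProj U (g * (𝔠).symm e) →
          modelInner mB y v w = modelInner mB (biquotientProj U (g * (𝔠).symm e)) v w := by
        rintro y rfl
        rfl
      refine Eq.trans ?_ (h1 _ ((extChartAt 𝓘(ℝ, F) (biquotientProj U g)).left_inv hs))
      conv_rhs => rw [← hinv v, ← hinv w]
      rfl
    rw [h, h, hb]
    refine modelInner_projDeriv hquot hmB _ (fun Z hZ ↦ hX Z ?_) A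
    rw [h, hZ, map_zero]

/-- The main criterion: the plane spanned by the projections of two horizontal vectors `X`, `Y` is
flat if the curvature of `G` and O'Neill's tensor vanish on it. -/
theorem hasZeroCurvaturePlane_of_flat [FiniteDimensional ℝ F] (hquot : IsQuotientManifold E F U)
    (hmB : IsInducedMetric m U mB) (g : G) {X Y : E} (hXY : LinearIndependent ℝ ![X, Y])
    (hX : ∀ Z ∈ modelVertical E U g, modelInner m 1 X Z = 0)
    (hY : ∀ Z ∈ modelVertical E U g, modelInner m 1 Y Z = 0)
    (hflat : modelInner m 1 (framedCurvature (leftFrame E G) (fun A B ↦ modelBracketL E G A B)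
      (fun _ ↦ invariantConnection (modelInner m 1) (modelBracketL E G)) e₀ X Y Y) X = 0)
    (hvert : ∀ Z : E × E, Z ∈ lieAlgebraOfProd (E := E) U → modelInner m 1 Y
      (-modelBracketL E G X (modelAd E g⁻¹ Z.1) + invariantConnection (modelInner m 1)
        (modelBracketL E G) X (modelAd E g⁻¹ Z.1 - Z.2)) = 0) :
    HasZeroCurvaturePlane mB (biquotientProj U g) := by
  have := FiniteDimensional.complete ℝ E
  have hsub := isFramedSubmersion_chartProj hquot hmB g
  have hm : (modelInner m 1).IsInvertible := isInvertible_of_pos (modelInner_pos m 1)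
  have hLC := isFramedLeviCivita_invariantConnection
    ((contDiffAt_leftFrame (E := E) (G := G)).of_le ENat.LEInfty.out)
    eventually_lieBracket_leftFrame hm modelBracketL_skew (modelInner_symm m 1)
  have hΦ : ∀ A : E, fderiv ℝ (chartProj E F U g) e₀ (leftFrame E G e₀ A)
      = modelDeriv F F (extChartAt 𝓘(ℝ, F) (biquotientProj U g)) (biquotientProj U g)
        (projDeriv E F U g A) := by
    intro A
    rw [(fderiv_chartProj hquot g).self_of_nhds, extChartAt_symm_chartOne, mul_one]
  have hker : ∀ Z, fderiv ℝ (chartProj E F U g) e₀ (leftFrame E G e₀ Z) = 0 →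
      Z ∈ modelVertical E U g := by
    intro Z hZ
    rw [hΦ, modelDeriv_extChartAt_self] at hZ
    exact mem_vertical_of_projDeriv hquot hmB g hZ
  have hcurv := hsub.metric_curvatureOperator hm hLC (fun Z hZ ↦ hX Z (hker Z hZ))
    (fun Z hZ ↦ hY Z (hker Z hZ)) hker (by
      rintro _ ⟨Z, hZ, rfl⟩
      have hd := (contDiffAt_invAdjoint (G := G) (modelAd E g⁻¹ Z.1)).differentiableAt (by simp)
      refine ⟨fun e ↦ invAdjoint G (modelAd E g⁻¹ Z.1) e - Z.2, ?_, hd.sub_const _, ?_, ?_⟩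
      · exact congrArg (· - Z.2) (invAdjoint_chartOne _)
      · filter_upwards [fderiv_chartProj hquot g, eventually_invAdjoint (E := E) (G := G)] with e h h'
        have h1 := projDeriv_vertical (F := F) hquot (g * (𝔠).symm e) hZ
        rw [mul_inv_rev, modelAd_mul] at h1
        rw [h, h']
        refine (congrArg _ h1).trans (map_zero _)
      · rw [fderiv_sub_const, fderiv_invAdjoint, leftFrame_chartOne]
        exact hvert Z hZ)
  rw [hflat, hΦ, hΦ, chartProj_chartOne] at hcurv
  refine ⟨projDeriv E F U g X, projDeriv E F U g Y, ?_, ?_⟩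
  · change LinearIndependent ℝ (M := F) ![projDeriv E F U g X, projDeriv E F U g Y]
    rw [LinearIndependent.pair_iff] at hXY ⊢
    intro s t hst
    apply hXY
    have h1 : projDeriv E F U g (s • X + t • Y) = 0 := by
      rw [map_add, map_smul, map_smul]
      exact hst
    by_contra hne
    refine (modelInner_pos m 1 _ hne).ne' ?_
    have h2 := mem_vertical_of_projDeriv hquot hmB g h1
    rw [map_add, map_smul, map_smul, modelInner_symm m 1 _ X, modelInner_symm m 1 _ Y, hX _ h2,
      hY _ h2, smul_zero, smul_zero, add_zero]
  · exact div_eq_zero_iff.2 (Or.inl hcurv)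

end Biquotient

section MetricTensor

variable {E : Type*} [NormedAddCommGroup E] [NormedSpace ℝ E] [FiniteDimensional ℝ E]
  {G : Type*} [TopologicalSpace G] [ChartedSpace E G] [Group G] [LieGroup 𝓘(ℝ, E) ∞ G]
  {m Q : SmoothMetric E G} {P : E →ₗ[ℝ] E} {U : Subgroup (G × G)}
  {F : Type*} [NormedAddCommGroup F] [NormedSpace ℝ F] [FiniteDimensional ℝ F]
  [ChartedSpace F (Biquotient U)] [IsManifold 𝓘(ℝ, F) ∞ (Biquotient U)]
  {mB : SmoothMetric F (Biquotient U)}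

theorem isMetricTensor_modelInner (hQ : IsBiInvariant Q)
    (hP : ∀ X Y : E, modelInner m 1 X Y = modelInner Q 1 X (P Y)) :
    IsMetricTensor (modelInner m 1) (modelInner Q 1) (modelBracketL E G) P where
  skew := modelBracketL_skew
  symm := modelInner_symm m 1
  pos := modelInner_pos m 1
  symm' := modelInner_symm Q 1
  pos' := modelInner_pos Q 1
  invariant :=
    have := FiniteDimensional.complete ℝ E
    bracket_skew_of_biInvariant hQ
  metric_eq := hP

theorem hasZeroCurvaturePlane_of_commuting
    (hT : IsMetricTensor (modelInner m 1) (modelInner Q 1) (modelBracketL E G) P)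
    (hquot : IsQuotientManifold E F U) (hmB : IsInducedMetric m U mB) (g : G)
    {W₁ W₂ : Submodule ℝ E} (h₁ : ∀ A ∈ W₁, P A ∈ W₁) (h₂ : ∀ A ∈ W₂, P A ∈ W₂)
    (h₁₂ : ∀ A ∈ W₁, ∀ B ∈ W₂, modelBracket E G A B = 0) {X Y : E} (hX : X ∈ W₁) (hY : Y ∈ W₂)
    (hYP : modelBracket E G Y (P Y) ∈ W₂) (hXY : LinearIndependent ℝ ![X, Y])
    (hXh : ∀ Z ∈ modelVertical E U g, modelInner m 1 X Z = 0)
    (hYh : ∀ Z ∈ modelVertical E U g, modelInner m 1 Y Z = 0) :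
    HasZeroCurvaturePlane mB (biquotientProj U g) := by
  have := FiniteDimensional.complete ℝ E
  simp only [← modelBracketL_eq] at h₁₂ hYP
  have h := hT.flat_of_commuting h₁ h₂ h₁₂ hX hY hYP (chartOne E G) (leftFrame E G)
  exact hasZeroCurvaturePlane_of_flat hquot hmB g hXY hXh hYh h.1 fun Z _ ↦ h.2 _ _

theorem hasZeroCurvaturePlane_of_eigenspace
    (hT : IsMetricTensor (modelInner m 1) (modelInner Q 1) (modelBracketL E G) P)
    (hm : IsLeftInvariant m) (hquot : IsQuotientManifold E F U) (hmB : IsInducedMetric m U mB)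
    (g : G) {V : Submodule ℝ E} {c : ℝ} (hPV : ∀ A ∈ V, P A = c • A)
    (hV : ∀ k ∈ invarianceGroup m, ∀ A ∈ V, modelAd E k A ∈ V)
    (hVU : ∀ A ∈ V, ∀ Z : E, Z ∈ lieAlgebraOf (E := E) (rightProjection U) →
      modelInner m 1 A Z = 0)
    {X Y : E} (hX : X ∈ lieAlgebraOf (E := E) (invarianceGroup m)) (hY : Y ∈ V)
    (hPXY : modelBracket E G (P X) Y = 0) (hXY : LinearIndependent ℝ ![X, Y])
    (hXh : ∀ Z ∈ modelVertical E U g, modelInner m 1 X Z = 0)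
    (hYh : ∀ Z ∈ modelVertical E U g, modelInner m 1 Y Z = 0) :
    HasZeroCurvaturePlane mB (biquotientProj U g) := by
  have := FiniteDimensional.complete ℝ E
  rw [← modelBracketL_eq] at hPXY
  have hmem : modelBracketL E G X Y ∈ V := bracket_mem_of_invariance hV hX hY
  have h := hT.flat_of_eigenspace (bracket_skew_of_invariance hm hX) (hPV Y hY) (hPV _ hmem) hPXY
    (chartOne E G) (leftFrame E G)
  refine hasZeroCurvaturePlane_of_flat hquot hmB g hXY hXh hYh h.1 fun Z hZ ↦ ?_
  have hZ2 : Z.2 ∈ lieAlgebraOf (E := E) (rightProjection U) := by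
    obtain ⟨γL, γR, -, hR, hU⟩ := hZ
    exact ⟨γR, hR, fun t ↦ ⟨_, hU t, rfl⟩⟩
  have h2 := h.2 (modelAd E g⁻¹ Z.1 - Z.2) Z.2 (hVU _ hmem _ hZ2)
  rwa [sub_add_cancel] at h2

end MetricTensor

theorem mainTheorem8
    {E : Type*} [NormedAddCommGroup E] [NormedSpace ℝ E] [FiniteDimensional ℝ E]
    {G : Type*} [TopologicalSpace G] [ChartedSpace E G] [Group G] [LieGroup 𝓘(ℝ, E) ∞ G]
    [CompactSpace G] [T2Space G]
    -- the left-invariant metric, the bi-invariant metric and the metric tensor `P`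
    (m : SmoothMetric E G) (hm : IsLeftInvariant m)
    (Q : SmoothMetric E G) (hQ : IsBiInvariant Q)
    (P : GroupLieAlgebra 𝓘(ℝ, E) G →ₗ[ℝ] GroupLieAlgebra 𝓘(ℝ, E) G)
    (hP : ∀ X Y : GroupLieAlgebra 𝓘(ℝ, E) G, m.inner (1 : G) X Y = Q.inner (1 : G) X (P Y))
    -- the group `U` acting on `G`
    (U : Subgroup (G × G)) (hU : IsClosed (U : Set (G × G)))
    (hUK : rightProjection U ≤ invarianceGroup m) (hfree : ActsFreelyModKernel U)
    -- the quotient manifold `G // U` with the induced metric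
    {F : Type*} [NormedAddCommGroup F] [NormedSpace ℝ F] [FiniteDimensional ℝ F]
    [ChartedSpace F (Biquotient U)] [IsManifold 𝓘(ℝ, F) ∞ (Biquotient U)]
    (hquot : IsQuotientManifold E F U)
    (mB : SmoothMetric F (Biquotient U)) (hmB : IsInducedMetric m U mB)
    (g : G) :
    -- (N1)
    ((∃ 𝔞 : Submodule ℝ (GroupLieAlgebra 𝓘(ℝ, E) G),
        (∀ A ∈ 𝔞, ∀ B ∈ 𝔞, ⁅A, B⁆ = 0) ∧ (∀ A ∈ 𝔞, P A ∈ 𝔞) ∧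
        ∃ X ∈ 𝔞, ∃ Y ∈ 𝔞, LinearIndependent ℝ ![X, Y] ∧
          IsHorizontal m U g X ∧ IsHorizontal m U g Y) →
      HasZeroCurvaturePlane mB (biquotientProj U g)) ∧
    -- (N2)
    ((∃ W₁ W₂ : Submodule ℝ (GroupLieAlgebra 𝓘(ℝ, E) G),
        (∀ A ∈ W₁, P A ∈ W₁) ∧ (∀ A ∈ W₂, P A ∈ W₂) ∧
        (∀ A ∈ W₁, ∀ B ∈ W₂, ⁅A, B⁆ = 0) ∧
        ∃ X ∈ W₁, ∃ Y ∈ W₂, LinearIndependent ℝ ![X, Y] ∧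
          IsHorizontal m U g X ∧ IsHorizontal m U g Y ∧ ⁅Y, P Y⁆ ∈ W₂) →
      HasZeroCurvaturePlane mB (biquotientProj U g)) ∧
    -- (N3)
    ((∃ (V : Submodule ℝ (GroupLieAlgebra 𝓘(ℝ, E) G)) (c : ℝ),
        (∀ A ∈ V, P A = c • A) ∧
        (∀ k ∈ invarianceGroup m, ∀ A ∈ V, adjointRep k A ∈ V) ∧
        (∀ A ∈ V, ∀ Z ∈ lieAlgebraOf (E := E) (rightProjection U), m.inner (1 : G) A Z = 0) ∧
        ∃ X ∈ lieAlgebraOf (E := E) (invarianceGroup m), ∃ Y ∈ V,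
          LinearIndependent ℝ ![X, Y] ∧
          IsHorizontal m U g X ∧ IsHorizontal m U g Y ∧ ⁅P X, Y⁆ = 0) →
      HasZeroCurvaturePlane mB (biquotientProj U g)) := by
  have hT := isMetricTensor_modelInner hQ hP
  refine ⟨?_, ?_, ?_⟩
  · rintro ⟨𝔞, hab, hP𝔞, X, hX, Y, hY, hXY, hXh, hYh⟩
    have hYP : ⁅Y, P Y⁆ ∈ 𝔞 := by
      rw [hab Y hY (P Y) (hP𝔞 Y hY)]
      exact 𝔞.zero_mem
    exact hasZeroCurvaturePlane_of_commuting hT hquot hmB g (W₁ := 𝔞) (W₂ := 𝔞) hP𝔞 hP𝔞 hab hX hY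
      hYP hXY hXh hYh
  · rintro ⟨W₁, W₂, h₁, h₂, h₁₂, X, hX, Y, hY, hXY, hXh, hYh, hYP⟩
    exact hasZeroCurvaturePlane_of_commuting hT hquot hmB g h₁ h₂ h₁₂ hX hY hYP hXY hXh hYh
  · rintro ⟨V, c, hPV, hV, hVU, X, hX, Y, hY, hXY, hXh, hYh, hPXY⟩
    exact hasZeroCurvaturePlane_of_eigenspace hT hm hquot hmB g hPV hV hVU hX hY hPXY hXY hXh hYh
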